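/- **Limit Harmonicity Lemma.** *Lattices.* A quadrilateral lattice $Q$ is a finite graph embedded in $\mathbb{C}$ with straight-line edges such that each bounded face is a (not necessarily convex) quadrilateral, the boundary $\partial Q$ of the outer face is a closed curve without self-intersections, and any two distinct bounded (closed) faces intersect in the empty set, a single vertex, or a single edge. Let $Q^0$ be its set of vertices. The lattice is orthogonal if the two diagonals of each face are orthogonal. Joining the opposite vertices in each face gives two graphs $B$ and $W$, each face having one diagonal in $B$ and the other one in $W$; $B$ denotes either one of the two and $B^0\subset Q^0$ its vertex set. A function $u\colon Q^0\to\mathbb{R}$ is discrete harmonic if it is the real part of a function $f\colon Q^0\to\mathbb{C}$ such that $$\frac{f(z_1)-f(z_3)}{z_1-z_3}=\frac{f(z_2)-f(z_4)}{z_2-z_4}$$ for each face $z_1z_2z_3z_4$. *Sequences.* A sequence $\{Q_n\}$ of lattices is nondegenerate uniform if there is a constant $C$ such that for every $n$: (D) in each face of $Q_n$ the ratio of the diagonals (in either order) is less than $C$ and the angle between them is greater than $1/C$; (U) each disk of radius equal to the maximal edge length of $Q_n$ contains fewer than $C$ vertices of $Q_n$. The sequence approximates a domain $\Omega$ if, as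 $n\to\infty$, the maximal distance from a point of $\partial Q_n$ to $\partial\Omega$, the maximal distance from a point of $\partial\Omega$ to $\partial Q_n$, and the maximal edge length of $Q_n$ all tend to zero. *Statement.* Let $\Omega\subset\mathbb{C}$ be a domain (a nonempty connected open set), and let $\{Q_n\}$ be a nondegenerate uniform sequence of orthogonal lattices approximating $\Omega$ such that some point of $\Omega$ lies inside the curve $\partial Q_n$ for all sufficiently large $n$. Let $u_n\colon Q_n^0\to\mathbb{R}$ be discrete harmonic functions and let $u\colon\Omega\to\mathbb{R}$ be a continuous function such that the restrictions $u_n|_{B_n^0}$ converge uniformly to $u$, that is, $\max_{z\in B_n^0\cap\Omega}|u_n(z)-u(z)|\to 0$ as $n\to\infty$. Then $u$ is harmonic in $\Omega$. -/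

import Mathlib

open Filter Topology

/-- A finite graph in the complex plane with rectilinear edges: finitely many vertices in `ℂ`, and
edges drawn as straight segments that meet only at common endpoints and contain no further
vertices. -/
structure PlaneGraph where
  /-- the vertices -/
  vertices : Finset ℂ
  /-- the adjacency relation -/
  graph : SimpleGraph vertices
  vertex_on_edge : ∀ a b v : vertices, graph.Adj a b →
    (v : ℂ) ∈ segment ℝ (a : ℂ) (b : ℂ) → v = a ∨ v = b
  edges_meet : ∀ a b c d : vertices, graph.Adj a b → graph.Adj c d → s(a, b) ≠ s(c, d) →
    segment ℝ (a : ℂ) (b : ℂ) ∩ segment ℝ (c : ℂ) (d : ℂ) ⊆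
      ({(a : ℂ), (b : ℂ)} : Set ℂ) ∩ {(c : ℂ), (d : ℂ)}

/-- The triangle with vertices `a`, `b`, `c` is nondegenerate, and its vertices are listed
clockwise. -/
def ClockwiseTriangle (a b c : ℂ) : Prop :=
  ((starRingEnd ℂ) (b - a) * (c - a)).im < 0

namespace PlaneGraph

variable (Q : PlaneGraph)

/-- The subset of the plane occupied by the graph: the union of its vertices and edges. -/
def carrier : Set ℂ :=
  {x | ∃ v : Q.vertices, x = v} ∪
    {x | ∃ a b : Q.vertices, Q.graph.Adj a b ∧ x ∈ segment ℝ (a : ℂ) (b : ℂ)}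

/-- The bounded faces: the bounded connected components of the complement of the graph. -/
def boundedFaces : Set (Set ℂ) :=
  {U | ∃ x ∈ Q.carrierᶜ, U = connectedComponentIn Q.carrierᶜ x ∧ Bornology.IsBounded U}

/-- The outer face: the unbounded connected component of the complement of the graph. -/
def outerFace : Set ℂ :=
  {x | x ∈ Q.carrierᶜ ∧ ¬ Bornology.IsBounded (connectedComponentIn Q.carrierᶜ x)}

/-- The boundary `∂Q`: the topological boundary of the outer face. -/
def boundary : Set ℂ := frontier Q.outerFace

/-- The points lying strictly inside `∂Q`: those neither in the outer face nor on `∂Q`. -/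
def inside : Set ℂ := (closure Q.outerFace)ᶜ

/-- `U` is the open (not necessarily convex) quadrilateral whose consecutive vertices, listed
clockwise, are `z₁ z₂ z₃ z₄`, and whose four sides are edges of the graph. Every simple
quadrilateral is cut into two triangles by a diagonal lying inside it; the labelling is chosen so
that this is the case for the diagonal `z₁z₃`. -/
def IsQuadrilateral (U : Set ℂ) (z₁ z₂ z₃ z₄ : Q.vertices) : Prop :=
  Q.graph.Adj z₁ z₂ ∧ Q.graph.Adj z₂ z₃ ∧ Q.graph.Adj z₃ z₄ ∧ Q.graph.Adj z₄ z₁ ∧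
  ClockwiseTriangle z₁ z₂ z₃ ∧ ClockwiseTriangle z₁ z₃ z₄ ∧
  U = interior (convexHull ℝ ({(z₁ : ℂ), (z₂ : ℂ), (z₃ : ℂ)} : Set ℂ) ∪
    convexHull ℝ ({(z₁ : ℂ), (z₃ : ℂ), (z₄ : ℂ)} : Set ℂ))

/-- `z₁ z₂ z₃ z₄` is a quadrilateral (bounded) face of the graph; its diagonals are `z₁z₃` and
`z₂z₄`. -/
def IsFace (z₁ z₂ z₃ z₄ : Q.vertices) : Prop :=
  ∃ U ∈ Q.boundedFaces, Q.IsQuadrilateral U z₁ z₂ z₃ z₄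

/-- Quadrilateral lattices: each bounded face is a quadrilateral, the boundary is a closed curve
without self-intersections, and two distinct (closed bounded) faces have either nothing, or a single
vertex, or a single edge in common. -/
structure IsQuadrilateralLattice : Prop where
  face_quadrilateral : ∀ U ∈ Q.boundedFaces, ∃ z₁ z₂ z₃ z₄ : Q.vertices,
    Q.IsQuadrilateral U z₁ z₂ z₃ z₄
  boundary_simple_closed : Nonempty (Q.boundary ≃ₜ Circle)
  faces_meet : ∀ U ∈ Q.boundedFaces, ∀ V ∈ Q.boundedFaces, U ≠ V →
    closure U ∩ closure V = ∅ ∨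
    (∃ v : Q.vertices, closure U ∩ closure V = {(v : ℂ)}) ∨
    (∃ a b : Q.vertices, Q.graph.Adj a b ∧ closure U ∩ closure V = segment ℝ (a : ℂ) (b : ℂ))

/-- Orthogonal lattices: the diagonals of each face are orthogonal. -/
structure IsOrthogonalLattice : Prop extends Q.IsQuadrilateralLattice where
  orthogonal : ∀ z₁ z₂ z₃ z₄ : Q.vertices, Q.IsFace z₁ z₂ z₃ z₄ →
    inner ℝ ((z₃ : ℂ) - z₁) ((z₄ : ℂ) - z₂) = 0

/-- The maximal edge length. -/
noncomputable def maxEdgeLength : ℝ :=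
  sSup {d : ℝ | ∃ a b : Q.vertices, Q.graph.Adj a b ∧ d = dist (a : ℂ) (b : ℂ)}

/-- `f` is discrete analytic: in each face, the difference quotients along the two diagonals are
equal. -/
def IsDiscreteAnalytic (f : Q.vertices → ℂ) : Prop :=
  ∀ z₁ z₂ z₃ z₄ : Q.vertices, Q.IsFace z₁ z₂ z₃ z₄ →
    (f z₁ - f z₃) / ((z₁ : ℂ) - z₃) = (f z₂ - f z₄) / ((z₂ : ℂ) - z₄)

/-- `u` is discrete harmonic: it is the real part of a discrete analytic function. -/
def IsDiscreteHarmonic (u : Q.vertices → ℝ) : Prop :=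
  ∃ f : Q.vertices → ℂ, Q.IsDiscreteAnalytic f ∧ ∀ z, u z = (f z).re

/-- `B` is the vertex set of one of the two graphs associated with the lattice, which are obtained by
joining opposite vertices in the faces: of the two diagonals of each face, one belongs to the graph
on `B`, the other one to the graph on the complementary set of vertices. -/
def IsDiagonalClass (B : Set Q.vertices) : Prop :=
  ∀ z₁ z₂ z₃ z₄ : Q.vertices, Q.IsFace z₁ z₂ z₃ z₄ →
    (z₁ ∈ B ∧ z₃ ∈ B ∧ z₂ ∉ B ∧ z₄ ∉ B) ∨ (z₁ ∉ B ∧ z₃ ∉ B ∧ z₂ ∈ B ∧ z₄ ∈ B)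

/-- Condition (D) with constant `C`: in each face, the ratio of the diagonals (in either order) is
less than `C`, and the angle between the lines containing them is greater than `1 / C`. -/
def DiagonalsNondegenerate (C : ℝ) : Prop :=
  ∀ z₁ z₂ z₃ z₄ : Q.vertices, Q.IsFace z₁ z₂ z₃ z₄ →
    dist (z₁ : ℂ) z₃ / dist (z₂ : ℂ) z₄ < C ∧
    dist (z₂ : ℂ) z₄ / dist (z₁ : ℂ) z₃ < C ∧
    1 / C < InnerProductGeometry.angle ((z₃ : ℂ) - z₁) ((z₄ : ℂ) - z₂) ∧
    InnerProductGeometry.angle ((z₃ : ℂ) - z₁) ((z₄ : ℂ) - z₂) < Real.pi - 1 / C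

/-- Condition (U) with constant `C`: each disk of radius equal to the maximal edge length contains
fewer than `C` vertices. -/
def VerticesUniform (C : ℝ) : Prop :=
  ∀ c : ℂ, (({v : Q.vertices | (v : ℂ) ∈ Metric.closedBall c Q.maxEdgeLength}.ncard : ℕ) : ℝ) < C

end PlaneGraph

/-- A nondegenerate uniform sequence: (D) and (U) hold with one constant for all members. -/
def NondegenerateUniform (Q : ℕ → PlaneGraph) : Prop :=
  ∃ C : ℝ, ∀ n, (Q n).DiagonalsNondegenerate C ∧ (Q n).VerticesUniform C

/-- The sequence of lattices approximates the domain `Ω`: the maximal distance from a point of `∂Qₙ`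
to `∂Ω`, the maximal distance from a point of `∂Ω` to `∂Qₙ`, and the maximal edge length of `Qₙ` all
tend to zero. -/
structure ApproximatesDomain (Q : ℕ → PlaneGraph) (Ω : Set ℂ) : Prop where
  boundary_near : ∀ ε > 0, ∀ᶠ n in atTop, ∀ z ∈ (Q n).boundary, ∃ w ∈ frontier Ω, dist z w < ε
  near_boundary : ∀ ε > 0, ∀ᶠ n in atTop, ∀ w ∈ frontier Ω, ∃ z ∈ (Q n).boundary, dist w z < ε
  mesh : Tendsto (fun n => (Q n).maxEdgeLength) atTop (𝓝 0)

/-! The limit is shown to be weakly harmonic: the integral of `v` against the Laplacian of `φ`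
vanishes for every C² function `φ` supported in a small disk. Weyl's lemma then gives harmonicity.
No energy or equicontinuity estimate for the discrete functions is needed.

Label a face clockwise `p q r s` with `p`, `r` in `B`. Orthogonality gives `s - q = -iκ(r - p)` with
`κ ≥ 0` and `κ|r - p|²` twice the area. Discrete analyticity of `f` then says that `κ(u(p) - u(r))`
is the increment of `Im f` from `q` to `s`. For a function `A(b, w)` of the edges, the circulation
of a face is `A(p,q) - A(r,q) + A(r,s) - A(p,s)`. An edge inside the boundary occurs in two faces
with opposite signs, so circulations sum to zero when `A` vanishes on all other edges
(`sum_circulation_eq_zero`).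

With `A = φ(b) Im f(w)` this is summation by parts: the sum over faces of `κ(φ(p) - φ(r))(u(p) -
u(r))` is zero. The same sum is evaluated by Taylor expansion of `φ` at both `p` and `r`. Since `i(s
- q) = κ(r - p)`, the first-order terms are exactly the circulation of `u(b) Dφ_b(iw)`. Keeping the
discrete `u` here leaves no error in the terms of lowest order. In the second-order terms `u` may be
replaced by `v`. The Hessian splits into its trace, which produces the Laplacian times the area, and
a traceless part, the real part of a multiple of the square of `r - p`. The latter is, up to a small
error, the circulation of a multiple of `(b - w)²` (`quadratic_form_eq`). What survives is a Riemann
sum for the integral of `v Δφ`.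

The error per face is at most `ε` times a constant multiple of area plus `h²` (`face_estimate`),
where `h` is the maximal edge length. Faces are disjoint, and (U) allows only `O(1/h²)` of them near
a fixed disk (`sq_mul_card_near_le`), so the total error is `O(ε)`. -/

/-! ### Triangles and quadrilaterals described by signed areas -/

/-- Twice the signed area of the triangle `a b x`. -/
def cross (a b x : ℂ) : ℝ := (b.re - a.re) * (x.im - a.im) - (b.im - a.im) * (x.re - a.re)

theorem clockwiseTriangle_iff_cross (a b c : ℂ) : ClockwiseTriangle a b c ↔ cross a b c < 0 := by
  unfold ClockwiseTriangle cross
  simp only [Complex.mul_im, Complex.conj_re, Complex.conj_im, Complex.sub_re, Complex.sub_im]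
  constructor <;> intro h <;> linarith

theorem cross_rotate (a b c : ℂ) : cross b c a = cross a b c := by unfold cross; ring

theorem cross_swap (a b c : ℂ) : cross b a c = - cross a b c := by unfold cross; ring

theorem cross_self_left (a b : ℂ) : cross a b a = 0 := by unfold cross; ring

theorem cross_self_right (a b : ℂ) : cross a b b = 0 := by unfold cross; ring

theorem cross_combo (a b x y : ℂ) {s t : ℝ} (h : s + t = 1) :
    cross a b (s • x + t • y) = s * cross a b x + t * cross a b y := by
  obtain rfl : s = 1 - t := by linarith
  unfold cross
  simp only [Complex.add_re, Complex.add_im, Complex.smul_re, Complex.smul_im, smul_eq_mul]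
  ring

theorem continuous_cross (a b : ℂ) : Continuous (cross a b) := by
  unfold cross; fun_prop

theorem convex_cross_nonpos (a b : ℂ) : Convex ℝ {x | cross a b x ≤ 0} := by
  intro x hx y hy s t hs ht hst
  simp only [Set.mem_ofPred_eq] at *
  rw [cross_combo a b x y hst]
  nlinarith

theorem convex_cross_neg (a b : ℂ) : Convex ℝ {x | cross a b x < 0} := by
  intro x hx y hy s t hs ht hst
  simp only [Set.mem_ofPred_eq] at *
  rw [cross_combo a b x y hst]
  rcases hs.eq_or_lt with h | h
  · subst h
    obtain rfl : t = 1 := by linarith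
    linarith
  · nlinarith [mul_neg_of_pos_of_neg h hx, mul_nonpos_of_nonneg_of_nonpos ht hy.le]

theorem cross_eq_zero_of_mem_segment {a b x : ℂ} (h : x ∈ segment ℝ a b) : cross a b x = 0 := by
  obtain ⟨s, t, -, -, hst, rfl⟩ := h
  rw [cross_combo a b a b hst, cross_self_left, cross_self_right]; ring

theorem cross_barycentric (a b c x : ℂ) (h : cross a b c ≠ 0) :
    (cross b c x / cross a b c) • a + (cross c a x / cross a b c) • b +
      (cross a b x / cross a b c) • c = x := by
  apply Complex.ext
  · simp only [Complex.add_re, Complex.smul_re, smul_eq_mul]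
    field_simp
    unfold cross; ring
  · simp only [Complex.add_im, Complex.smul_im, smul_eq_mul]
    field_simp
    unfold cross; ring

theorem cross_add_cross_add_cross (a b c x : ℂ) :
    cross b c x + cross c a x + cross a b x = cross a b c := by unfold cross; ring

theorem mem_convexHull_triangle {a b c : ℂ} (h : cross a b c < 0) (x : ℂ) :
    x ∈ convexHull ℝ ({a, b, c} : Set ℂ) ↔
      cross a b x ≤ 0 ∧ cross b c x ≤ 0 ∧ cross c a x ≤ 0 := by
  constructor
  · intro hx
    have hb : cross b c a < 0 := by rwa [cross_rotate]
    have hc : cross c a b < 0 := by rwa [cross_rotate, cross_rotate]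
    have key : convexHull ℝ ({a, b, c} : Set ℂ) ⊆
        {x | cross a b x ≤ 0} ∩ ({x | cross b c x ≤ 0} ∩ {x | cross c a x ≤ 0}) := by
      refine convexHull_min ?_ ((convex_cross_nonpos a b).inter
        ((convex_cross_nonpos b c).inter (convex_cross_nonpos c a)))
      rintro y (rfl | rfl | rfl)
      · exact ⟨(cross_self_left _ _).le, hb.le, (cross_self_right _ _).le⟩
      · exact ⟨(cross_self_right _ _).le, (cross_self_left _ _).le, hc.le⟩
      · exact ⟨h.le, (cross_self_right _ _).le, (cross_self_left _ _).le⟩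
    exact key hx
  · rintro ⟨h1, h2, h3⟩
    have e := cross_barycentric a b c x h.ne
    have hs : ∑ i : Fin 3, (![cross b c x / cross a b c, cross c a x / cross a b c,
        cross a b x / cross a b c] i) = 1 := by
      simp only [Fin.sum_univ_three, Matrix.cons_val_zero, Matrix.cons_val_one, Matrix.cons_val]
      rw [← add_div, ← add_div, cross_add_cross_add_cross, div_self h.ne]
    have := (convex_convexHull ℝ ({a, b, c} : Set ℂ)).sum_mem (t := Finset.univ)
      (w := ![cross b c x / cross a b c, cross c a x / cross a b c,
        cross a b x / cross a b c]) (z := ![a, b, c]) ?_ hs ?_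
    · simp only [Fin.sum_univ_three, Matrix.cons_val_zero, Matrix.cons_val_one,
        Matrix.cons_val] at this
      rwa [e] at this
    · intro i _
      fin_cases i <;> exact div_nonneg_of_nonpos (by assumption) h.le
    · intro i _
      apply subset_convexHull
      fin_cases i <;> simp

theorem mem_segment_of_cross_eq_zero {a b c x : ℂ} (h : cross a b c < 0)
    (hx : x ∈ convexHull ℝ ({a, b, c} : Set ℂ)) (h0 : cross a b x = 0) : x ∈ segment ℝ a b := by
  rw [mem_convexHull_triangle h] at hx
  have e := cross_barycentric a b c x h.ne
  have hs := cross_add_cross_add_cross a b c x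
  rw [h0] at e hs
  refine ⟨_, _, div_nonneg_of_nonpos hx.2.1 h.le, div_nonneg_of_nonpos hx.2.2 h.le, ?_, ?_⟩
  · rw [← add_div, ← hs, add_zero, div_self]
    rw [add_zero] at hs
    rw [hs]; exact h.ne
  · simpa using e

/-- The closed quadrilateral cut by its diagonal `ac` into two triangles. -/
def quadRegion (a b c d : ℂ) : Set ℂ :=
  convexHull ℝ ({a, b, c} : Set ℂ) ∪ convexHull ℝ ({a, c, d} : Set ℂ)

/-- The half turn of the labels keeps the cutting diagonal, so facts about the sides `ab` and `bc`
transfer to `cd` and `da`. -/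
theorem quadRegion_rotate (a b c d : ℂ) : quadRegion c d a b = quadRegion a b c d := by
  unfold quadRegion
  rw [Set.union_comm]
  congr 2
  · ext; simp; tauto
  · ext; simp; tauto

/-- Off the diagonal `ac` the point is interior to the triangle. On it, all four side inequalities
are strict and persist nearby, and the sign of `cross c a y` decides which triangle contains the
nearby point `y`. Convexity of the quadrilateral plays no role. -/
theorem mem_interior_quadRegion_of_mem_left {a b c d x : ℂ} (h₁ : cross a b c < 0)
    (h₂ : cross a c d < 0) (hx : x ∈ convexHull ℝ ({a, b, c} : Set ℂ))
    (hab : x ∉ segment ℝ a b) (hbc : x ∉ segment ℝ b c) : x ∈ interior (quadRegion a b c d) := by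
  have hx' := (mem_convexHull_triangle h₁ x).1 hx
  have h₁' : cross b c a < 0 := by rwa [cross_rotate]
  have n1 : cross a b x < 0 := lt_of_le_of_ne hx'.1 fun h =>
    hab (mem_segment_of_cross_eq_zero h₁ hx h)
  have n2 : cross b c x < 0 := lt_of_le_of_ne hx'.2.1 fun h =>
    hbc (mem_segment_of_cross_eq_zero h₁' (by convert hx using 2; ext; simp; tauto) h)
  rcases hx'.2.2.lt_or_eq with n3 | n3
  · rw [mem_interior]
    refine ⟨{y | cross a b y < 0} ∩ ({y | cross b c y < 0} ∩ {y | cross c a y < 0}), ?_, ?_,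
      n1, n2, n3⟩
    · rintro y ⟨y1, y2, y3⟩
      exact Or.inl ((mem_convexHull_triangle h₁ y).2 ⟨y1.le, y2.le, y3.le⟩)
    · exact (isOpen_lt (continuous_cross _ _) continuous_const).inter
        ((isOpen_lt (continuous_cross _ _) continuous_const).inter
          (isOpen_lt (continuous_cross _ _) continuous_const))
  · have e := cross_barycentric a b c x h₁.ne
    have hs := cross_add_cross_add_cross a b c x
    rw [n3] at e hs
    have hst : cross b c x / cross a b c + cross a b x / cross a b c = 1 := by
      rw [← add_div, ← hs, add_zero, div_self]; linarith
    have e' : (cross b c x / cross a b c) • a + (cross a b x / cross a b c) • c = x := by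
      simpa using e
    have n4 : cross c d x < 0 := by
      rw [← e', cross_combo c d a c hst, cross_self_left, cross_rotate a c d]
      have := div_pos_of_neg_of_neg n2 h₁
      nlinarith
    have n5 : cross d a x < 0 := by
      rw [← e', cross_combo d a a c hst, cross_self_right]
      have := div_pos_of_neg_of_neg n1 h₁
      have h₃ : cross d a c < 0 := by rwa [cross_rotate, cross_rotate]
      nlinarith
    rw [mem_interior]
    refine ⟨{y | cross a b y < 0} ∩ ({y | cross b c y < 0} ∩ ({y | cross c d y < 0} ∩
      {y | cross d a y < 0})), ?_, ?_, n1, n2, n4, n5⟩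
    · rintro y ⟨y1, y2, y3, y4⟩
      rcases le_or_gt (cross c a y) 0 with h | h
      · exact Or.inl ((mem_convexHull_triangle h₁ y).2 ⟨y1.le, y2.le, h⟩)
      · refine Or.inr ((mem_convexHull_triangle h₂ y).2 ⟨?_, y3.le, y4.le⟩)
        rw [cross_swap]; linarith
    · exact (isOpen_lt (continuous_cross _ _) continuous_const).inter
        ((isOpen_lt (continuous_cross _ _) continuous_const).inter
          ((isOpen_lt (continuous_cross _ _) continuous_const).inter
            (isOpen_lt (continuous_cross _ _) continuous_const)))

theorem mem_interior_quadRegion {a b c d x : ℂ} (h₁ : cross a b c < 0) (h₂ : cross a c d < 0)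
    (hx : x ∈ quadRegion a b c d) (hab : x ∉ segment ℝ a b) (hbc : x ∉ segment ℝ b c)
    (hcd : x ∉ segment ℝ c d) (hda : x ∉ segment ℝ d a) : x ∈ interior (quadRegion a b c d) := by
  rcases hx with hx | hx
  · exact mem_interior_quadRegion_of_mem_left h₁ h₂ hx hab hbc
  · rw [← quadRegion_rotate]
    refine mem_interior_quadRegion_of_mem_left ?_ ?_ ?_ hcd hda
    · rwa [cross_rotate]
    · rwa [← cross_rotate]
    · convert hx using 2; ext; simp; tauto

theorem eventually_cross_neg {a b m : ℂ} (h : cross a b m < 0) : ∀ᶠ y in 𝓝 m, cross a b y < 0 :=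
  (continuous_cross a b).continuousAt.eventually (gt_mem_nhds h)

theorem quadRegion_near_side_ab {a b c d m : ℂ} (h₁ : cross a b c < 0) (h₂ : cross a c d < 0)
    (hm : m ∈ openSegment ℝ a b) :
    ∀ᶠ y in 𝓝 m, (cross a b y < 0 → y ∈ quadRegion a b c d) ∧
      (0 < cross a b y → y ∉ quadRegion a b c d) := by
  obtain ⟨s, t, hs, ht, hst, rfl⟩ := hm
  have n1 : cross b c (s • a + t • b) < 0 := by
    rw [cross_combo b c a b hst, cross_self_left, cross_rotate]; nlinarith
  have n2 : cross c a (s • a + t • b) < 0 := by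
    rw [cross_combo c a a b hst, cross_self_right]
    have : cross c a b < 0 := by rwa [cross_rotate, cross_rotate]
    nlinarith
  filter_upwards [eventually_cross_neg n1, eventually_cross_neg n2] with y y1 y2
  refine ⟨fun h => Or.inl ((mem_convexHull_triangle h₁ y).2 ⟨h.le, y1.le, y2.le⟩), ?_⟩
  rintro h (h' | h')
  · exact absurd ((mem_convexHull_triangle h₁ y).1 h').1 (not_le.2 h)
  · have := ((mem_convexHull_triangle h₂ y).1 h').1
    rw [cross_swap] at this; linarith

theorem quadRegion_near_side_bc {a b c d m : ℂ} (h₁ : cross a b c < 0) (h₂ : cross a c d < 0)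
    (hm : m ∈ openSegment ℝ b c) :
    ∀ᶠ y in 𝓝 m, (cross b c y < 0 → y ∈ quadRegion a b c d) ∧
      (0 < cross b c y → y ∉ quadRegion a b c d) := by
  obtain ⟨s, t, hs, ht, hst, rfl⟩ := hm
  have n1 : cross a b (s • b + t • c) < 0 := by
    rw [cross_combo a b b c hst, cross_self_right]; nlinarith
  have n2 : cross c a (s • b + t • c) < 0 := by
    rw [cross_combo c a b c hst, cross_self_left]
    have : cross c a b < 0 := by rwa [cross_rotate, cross_rotate]
    nlinarith
  filter_upwards [eventually_cross_neg n1, eventually_cross_neg n2] with y y1 y2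
  refine ⟨fun h => Or.inl ((mem_convexHull_triangle h₁ y).2 ⟨y1.le, h.le, y2.le⟩), ?_⟩
  rintro h (h' | h')
  · exact absurd ((mem_convexHull_triangle h₁ y).1 h').2.1 (not_le.2 h)
  · have := ((mem_convexHull_triangle h₂ y).1 h').1
    rw [cross_swap] at this; linarith

/-- `(x, y)` is one of the four sides of the quadrilateral `abcd`, in the listed direction. -/
def IsSide {α : Type*} (a b c d x y : α) : Prop :=
  (x = a ∧ y = b) ∨ (x = b ∧ y = c) ∨ (x = c ∧ y = d) ∨ (x = d ∧ y = a)

theorem quadRegion_near_side {a b c d x y m : ℂ} (h₁ : cross a b c < 0) (h₂ : cross a c d < 0)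
    (hs : IsSide a b c d x y) (hm : m ∈ openSegment ℝ x y) :
    ∀ᶠ z in 𝓝 m, (cross x y z < 0 → z ∈ interior (quadRegion a b c d)) ∧
      (0 < cross x y z → z ∉ interior (quadRegion a b c d)) := by
  have key : ∀ᶠ z in 𝓝 m, (cross x y z < 0 → z ∈ quadRegion a b c d) ∧
      (0 < cross x y z → z ∉ quadRegion a b c d) := by
    have h₃ : cross c d a < 0 := by rwa [cross_rotate]
    have h₄ : cross c a b < 0 := by rwa [← cross_rotate]
    rcases hs with ⟨rfl, rfl⟩ | ⟨rfl, rfl⟩ | ⟨rfl, rfl⟩ | ⟨rfl, rfl⟩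
    · exact quadRegion_near_side_ab h₁ h₂ hm
    · exact quadRegion_near_side_bc h₁ h₂ hm
    · rw [← quadRegion_rotate]
      exact quadRegion_near_side_ab h₃ h₄ hm
    · rw [← quadRegion_rotate]
      exact quadRegion_near_side_bc h₃ h₄ hm
  -- What holds near `m` holds near every point `z` close to `m`; this upgrades membership in the
  -- region to membership in its interior.
  filter_upwards [key.eventually_nhds] with z hz
  refine ⟨fun h => ?_, fun h h' => hz.self_of_nhds.2 h (interior_subset h')⟩
  rw [mem_interior_iff_mem_nhds]
  filter_upwards [hz, eventually_cross_neg h] with w hw hw' using hw.1 hw'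

/-! ### The face to the right of an inner edge -/

namespace PlaneGraph

variable (Q : PlaneGraph)

theorem isClosed_carrier : IsClosed Q.carrier := by
  have h : Q.carrier = (⋃ v : Q.vertices, {(v : ℂ)}) ∪
      ⋃ a : Q.vertices, ⋃ b : Q.vertices, ⋃ _ : Q.graph.Adj a b, segment ℝ (a : ℂ) (b : ℂ) := by
    ext x; simp [carrier]
  rw [h]
  refine (isClosed_iUnion_of_finite fun _ => isClosed_singleton).union ?_
  refine isClosed_iUnion_of_finite fun a => isClosed_iUnion_of_finite fun b =>
    isClosed_iUnion_of_finite fun _ => ?_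
  rw [← convexHull_pair]
  exact ((Set.toFinite _).isCompact_convexHull ℝ).isClosed

variable {Q}

theorem coe_ne_of_adj {a b : Q.vertices} (h : Q.graph.Adj a b) : (a : ℂ) ≠ b :=
  fun e => h.ne (Subtype.ext e)

theorem ne_vertex_of_mem_openSegment {a b : Q.vertices} (hab : Q.graph.Adj a b) {m : ℂ}
    (hm : m ∈ openSegment ℝ (a : ℂ) b) (v : Q.vertices) : m ≠ v := by
  rintro rfl
  have hne := coe_ne_of_adj hab
  rcases Q.vertex_on_edge a b v hab (openSegment_subset_segment ℝ _ _ hm) with rfl | rfl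
  · exact hne (left_mem_openSegment_iff.1 hm)
  · exact hne (right_mem_openSegment_iff.1 hm)

theorem edge_eq_of_mem_openSegment {a b c d : Q.vertices} (hab : Q.graph.Adj a b)
    (hcd : Q.graph.Adj c d) {m : ℂ} (hm : m ∈ openSegment ℝ (a : ℂ) b)
    (hm' : m ∈ segment ℝ (c : ℂ) d) : s(a, b) = s(c, d) := by
  by_contra h
  have := (Q.edges_meet a b c d hab hcd h ⟨openSegment_subset_segment ℝ _ _ hm, hm'⟩).1
  rcases this with h | h
  · exact ne_vertex_of_mem_openSegment hab hm a h
  · exact ne_vertex_of_mem_openSegment hab hm b h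

/-- All vertices and all other edges form finitely many closed sets that miss `m`. -/
theorem eventually_mem_segment_of_mem_carrier {a b : Q.vertices} (hab : Q.graph.Adj a b) {m : ℂ}
    (hm : m ∈ openSegment ℝ (a : ℂ) b) :
    ∀ᶠ y in 𝓝 m, y ∈ Q.carrier → y ∈ segment ℝ (a : ℂ) b := by
  have h1 : ∀ᶠ y : ℂ in 𝓝 m, ∀ v : Q.vertices, y ≠ v :=
    eventually_all.2 fun v => isOpen_ne.mem_nhds (ne_vertex_of_mem_openSegment hab hm v)
  have h2 : ∀ᶠ y in 𝓝 m, ∀ c d : Q.vertices, Q.graph.Adj c d → y ∈ segment ℝ (c : ℂ) d →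
      s(a, b) = s(c, d) := by
    refine eventually_all.2 fun c => eventually_all.2 fun d => ?_
    by_cases hm' : m ∈ segment ℝ (c : ℂ) d
    · exact Eventually.of_forall fun y hcd _ => edge_eq_of_mem_openSegment hab hcd hm hm'
    · have hc : IsClosed (segment ℝ (c : ℂ) d) := by
        rw [← convexHull_pair]
        exact ((Set.toFinite _).isCompact_convexHull ℝ).isClosed
      filter_upwards [hc.isOpen_compl.mem_nhds hm'] with y hy _ hy'
      exact absurd hy' hy
  filter_upwards [h1, h2] with y y1 y2
  rintro (⟨v, hv⟩ | ⟨c, d, hcd, hy⟩)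
  · exact absurd hv (y1 v)
  · rcases Sym2.eq_iff.1 (y2 c d hcd hy) with ⟨rfl, rfl⟩ | ⟨rfl, rfl⟩
    · exact hy
    · rwa [segment_symm]

theorem isOpen_of_mem_boundedFaces {U : Set ℂ} (hU : U ∈ Q.boundedFaces) : IsOpen U := by
  obtain ⟨x, -, rfl, -⟩ := hU
  exact Q.isClosed_carrier.isOpen_compl.connectedComponentIn

theorem disjoint_carrier_of_mem_boundedFaces {U : Set ℂ} (hU : U ∈ Q.boundedFaces) {x : ℂ}
    (hx : x ∈ U) : x ∉ Q.carrier := by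
  obtain ⟨y, -, rfl, -⟩ := hU
  exact connectedComponentIn_subset _ _ hx

theorem boundedFaces_eq_of_mem {U V : Set ℂ} (hU : U ∈ Q.boundedFaces) (hV : V ∈ Q.boundedFaces)
    {x : ℂ} (hxU : x ∈ U) (hxV : x ∈ V) : U = V := by
  obtain ⟨y, -, rfl, -⟩ := hU
  obtain ⟨z, -, rfl, -⟩ := hV
  rw [connectedComponentIn_eq hxU, connectedComponentIn_eq hxV]

theorem connectedComponentIn_mem_boundedFaces {x : ℂ} (hx : x ∈ Q.inside) (hc : x ∉ Q.carrier) :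
    connectedComponentIn Q.carrierᶜ x ∈ Q.boundedFaces := by
  refine ⟨x, hc, rfl, ?_⟩
  by_contra h
  exact hx (subset_closure ⟨hc, h⟩)

theorem isOpen_inside : IsOpen Q.inside := isClosed_closure.isOpen_compl

theorem exists_cross_neg_mem_nhds {a b m : ℂ} (hab : a ≠ b) (hm : cross a b m = 0) {s : Set ℂ}
    (hs : s ∈ 𝓝 m) : ∃ x ∈ s, cross a b x < 0 := by
  -- Moving off the line perpendicularly to the right lowers the signed area by `t|b - a|²`.
  have ht : Tendsto (fun t : ℝ => m - t • (Complex.I * (b - a))) (𝓝[>] 0) (𝓝 m) := by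
    have : Continuous fun t : ℝ => m - t • (Complex.I * (b - a)) := by fun_prop
    have h := this.tendsto 0
    simp only [zero_smul, sub_zero] at h
    exact h.mono_left nhdsWithin_le_nhds
  obtain ⟨t, h1, h2⟩ := ((ht.eventually hs).and self_mem_nhdsWithin).exists
  refine ⟨_, h1, ?_⟩
  have e : cross a b (m - t • (Complex.I * (b - a))) = cross a b m - t * Complex.normSq (b - a) := by
    simp only [cross, Complex.normSq_apply, Complex.sub_re, Complex.sub_im, Complex.smul_re,
      Complex.smul_im, Complex.mul_re, Complex.mul_im, Complex.I_re, Complex.I_im, smul_eq_mul]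
    ring
  rw [e, hm]
  have : 0 < Complex.normSq (b - a) := Complex.normSq_pos.2 (sub_ne_zero.2 hab.symm)
  have := mul_pos (Set.mem_Ioi.1 h2) this
  linarith

/-- A small half-disk to the right of the edge is convex and misses the graph, hence lies in one
component of the complement. That component is bounded because it contains a point off the outer
face. This local argument makes the Jordan curve theorem unnecessary. -/
theorem exists_face_right {a b : Q.vertices} (hab : Q.graph.Adj a b) {m : ℂ}
    (hm : m ∈ openSegment ℝ (a : ℂ) b) (hi : m ∈ Q.inside) :
    ∃ U ∈ Q.boundedFaces, ∀ᶠ y in 𝓝 m, cross a b y < 0 → y ∈ U := by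
  have hm0 := cross_eq_zero_of_mem_segment (openSegment_subset_segment ℝ _ _ hm)
  obtain ⟨ε, hε, hball⟩ := Metric.eventually_nhds_iff_ball.1
    ((eventually_mem_segment_of_mem_carrier hab hm).and (isOpen_inside.mem_nhds hi))
  set H := Metric.ball m ε ∩ {y | cross (a : ℂ) b y < 0} with hH
  have hHc : H ⊆ Q.carrierᶜ := fun y hy hyc =>
    (hy.2 : cross (a : ℂ) b y < 0).ne (cross_eq_zero_of_mem_segment ((hball y hy.1).1 hyc))
  have hHp : IsPreconnected H :=
    ((convex_ball m ε).inter (convex_cross_neg _ _)).isPreconnected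
  obtain ⟨x, hx1, hx2⟩ := exists_cross_neg_mem_nhds (coe_ne_of_adj hab) hm0
    (Metric.ball_mem_nhds m hε)
  have hxH : x ∈ H := ⟨hx1, hx2⟩
  refine ⟨_, connectedComponentIn_mem_boundedFaces (hball x hx1).2 (hHc hxH), ?_⟩
  filter_upwards [Metric.ball_mem_nhds m hε] with y hy hy'
  exact hHp.subset_connectedComponentIn hxH hHc ⟨hy, hy'⟩

theorem IsQuadrilateral.cross_left {U : Set ℂ} {z₁ z₂ z₃ z₄ : Q.vertices}
    (h : Q.IsQuadrilateral U z₁ z₂ z₃ z₄) : cross z₁ z₂ z₃ < 0 :=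
  (clockwiseTriangle_iff_cross _ _ _).1 h.2.2.2.2.1

theorem IsQuadrilateral.cross_right {U : Set ℂ} {z₁ z₂ z₃ z₄ : Q.vertices}
    (h : Q.IsQuadrilateral U z₁ z₂ z₃ z₄) : cross z₁ z₃ z₄ < 0 :=
  (clockwiseTriangle_iff_cross _ _ _).1 h.2.2.2.2.2.1

theorem IsQuadrilateral.eq_interior {U : Set ℂ} {z₁ z₂ z₃ z₄ : Q.vertices}
    (h : Q.IsQuadrilateral U z₁ z₂ z₃ z₄) : U = interior (quadRegion z₁ z₂ z₃ z₄) :=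
  h.2.2.2.2.2.2

theorem IsQuadrilateral.near_side {U : Set ℂ} {z₁ z₂ z₃ z₄ a b : Q.vertices}
    (h : Q.IsQuadrilateral U z₁ z₂ z₃ z₄) (hs : IsSide z₁ z₂ z₃ z₄ a b) {m : ℂ}
    (hm : m ∈ openSegment ℝ (a : ℂ) b) :
    ∀ᶠ y in 𝓝 m, (cross a b y < 0 → y ∈ U) ∧ (0 < cross a b y → y ∉ U) := by
  rw [h.eq_interior]
  refine quadRegion_near_side h.cross_left h.cross_right ?_ hm
  unfold IsSide at hs ⊢
  simpa only [Subtype.ext_iff] using hs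

theorem isClosed_quadRegion (a b c d : ℂ) : IsClosed (quadRegion a b c d) :=
  ((Set.toFinite _).isCompact_convexHull ℝ).isClosed.union
    ((Set.toFinite _).isCompact_convexHull ℝ).isClosed

/-- The point `m` is a limit of points of `U` but lies on the graph, so it is on the rim of the
quadrilateral and thus on one of its sides, which must be the given edge. The reversed direction is
impossible: the face would then lie on the other side of the edge. -/
theorem IsQuadrilateral.isSide {U : Set ℂ} {z₁ z₂ z₃ z₄ a b : Q.vertices}
    (h : Q.IsQuadrilateral U z₁ z₂ z₃ z₄) (hU : U ∈ Q.boundedFaces) (hab : Q.graph.Adj a b) {m : ℂ}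
    (hm : m ∈ openSegment ℝ (a : ℂ) b) (hr : ∀ᶠ y in 𝓝 m, cross a b y < 0 → y ∈ U) :
    IsSide z₁ z₂ z₃ z₄ a b := by
  have hm0 := cross_eq_zero_of_mem_segment (openSegment_subset_segment ℝ _ _ hm)
  have hmU : m ∉ U := fun hmU => disjoint_carrier_of_mem_boundedFaces hU hmU
    (Or.inr ⟨a, b, hab, openSegment_subset_segment ℝ _ _ hm⟩)
  have hmR : m ∈ quadRegion (z₁ : ℂ) z₂ z₃ z₄ := by
    rw [← (isClosed_quadRegion _ _ _ _).closure_eq, mem_closure_iff_nhds]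
    intro t ht
    obtain ⟨x, hx, hx'⟩ := exists_cross_neg_mem_nhds (coe_ne_of_adj hab) hm0 (inter_mem ht hr)
    refine ⟨x, hx.1, ?_⟩
    have := hx.2 hx'
    rw [h.eq_interior] at this
    exact interior_subset this
  have flip : ∀ {c d : Q.vertices}, IsSide z₁ z₂ z₃ z₄ c d → Q.graph.Adj c d →
      m ∈ segment ℝ (c : ℂ) d → IsSide z₁ z₂ z₃ z₄ a b := by
    intro c d hcd hadj hmcd
    rcases Sym2.eq_iff.1 (edge_eq_of_mem_openSegment hab hadj hm hmcd) with ⟨rfl, rfl⟩ | ⟨rfl, rfl⟩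
    · exact hcd
    · exfalso
      have hm' : m ∈ openSegment ℝ (b : ℂ) a := by rwa [openSegment_symm]
      obtain ⟨x, ⟨hx1, hx2⟩, hx'⟩ := exists_cross_neg_mem_nhds (coe_ne_of_adj hab) hm0
        (inter_mem hr (h.near_side hcd hm'))
      refine hx2.2 ?_ (hx1 hx')
      rw [cross_swap]; linarith
  by_contra hns
  have hi := mem_interior_quadRegion h.cross_left h.cross_right hmR
    (fun hs => hns (flip (Or.inl ⟨rfl, rfl⟩) h.1 hs))
    (fun hs => hns (flip (Or.inr (Or.inl ⟨rfl, rfl⟩)) h.2.1 hs))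
    (fun hs => hns (flip (Or.inr (Or.inr (Or.inl ⟨rfl, rfl⟩))) h.2.2.1 hs))
    (fun hs => hns (flip (Or.inr (Or.inr (Or.inr ⟨rfl, rfl⟩))) h.2.2.2.1 hs))
  rw [← h.eq_interior] at hi
  exact hmU hi

/-- Both faces contain the points just to the right of the midpoint, and components that meet
coincide. -/
theorem IsQuadrilateral.face_eq_of_side {U V : Set ℂ} {z₁ z₂ z₃ z₄ w₁ w₂ w₃ w₄ a b : Q.vertices}
    (h : Q.IsQuadrilateral U z₁ z₂ z₃ z₄) (hU : U ∈ Q.boundedFaces)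
    (h' : Q.IsQuadrilateral V w₁ w₂ w₃ w₄) (hV : V ∈ Q.boundedFaces) (hab : a ≠ b)
    (hs : IsSide z₁ z₂ z₃ z₄ a b) (hs' : IsSide w₁ w₂ w₃ w₄ a b) : U = V := by
  have hm : midpoint ℝ (a : ℂ) b ∈ openSegment ℝ (a : ℂ) b :=
    midpoint_mem_openSegment _ _
  have hm0 := cross_eq_zero_of_mem_segment (openSegment_subset_segment ℝ _ _ hm)
  obtain ⟨x, ⟨h1, h2⟩, hx⟩ := exists_cross_neg_mem_nhds (fun e => hab (Subtype.ext e)) hm0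
    (inter_mem (h.near_side hs hm) (h'.near_side hs' hm))
  exact boundedFaces_eq_of_mem hU hV (h1.1 hx) (h2.1 hx)

end PlaneGraph

/-! ### Two-coloured labelling of the faces and the discrete Stokes formula -/

theorem isSide_rotate {α : Type*} {a b c d x y : α} (h : IsSide b c d a x y) :
    IsSide a b c d x y := by
  unfold IsSide at *; tauto

namespace PlaneGraph

variable {Q : PlaneGraph}

theorem IsQuadrilateral.ne₁₃ {U : Set ℂ} {z₁ z₂ z₃ z₄ : Q.vertices}
    (h : Q.IsQuadrilateral U z₁ z₂ z₃ z₄) : z₁ ≠ z₃ := by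
  rintro rfl
  exact h.cross_left.ne (cross_eq_zero_of_mem_segment (left_mem_segment ℝ _ _))

theorem IsQuadrilateral.ne₂₄ {U : Set ℂ} {z₁ z₂ z₃ z₄ : Q.vertices}
    (h : Q.IsQuadrilateral U z₁ z₂ z₃ z₄) : z₂ ≠ z₄ := by
  rintro rfl
  have h1 := h.cross_left
  have h2 := h.cross_right
  unfold cross at h1 h2
  linarith

theorem IsQuadrilateral.adj_of_isSide {U : Set ℂ} {z₁ z₂ z₃ z₄ a b : Q.vertices}
    (h : Q.IsQuadrilateral U z₁ z₂ z₃ z₄) (hs : IsSide z₁ z₂ z₃ z₄ a b) : Q.graph.Adj a b := by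
  rcases hs with ⟨rfl, rfl⟩ | ⟨rfl, rfl⟩ | ⟨rfl, rfl⟩ | ⟨rfl, rfl⟩
  exacts [h.1, h.2.1, h.2.2.1, h.2.2.2.1]

theorem IsQuadrilateralLattice.finite_boundedFaces (hQ : Q.IsQuadrilateralLattice) :
    Q.boundedFaces.Finite := by
  refine (Set.finite_range fun z : Q.vertices × Q.vertices × Q.vertices × Q.vertices =>
    interior (quadRegion (z.1 : ℂ) z.2.1 z.2.2.1 z.2.2.2)).subset ?_
  intro U hU
  obtain ⟨z₁, z₂, z₃, z₄, h⟩ := hQ.face_quadrilateral U hU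
  exact ⟨(z₁, z₂, z₃, z₄), h.eq_interior.symm⟩

/-- The vertices of the quadrilateral `U`, listed clockwise, are `p q r s`, and `p`, `r` lie in `B`
whereas `q`, `s` do not. -/
structure IsLabelling (B : Set Q.vertices) (U : Set ℂ) (p q r s : Q.vertices) : Prop where
  left_mem : p ∈ B
  right_mem : r ∈ B
  up_notMem : q ∉ B
  down_notMem : s ∉ B
  quad : Q.IsQuadrilateral U p q r s ∨ Q.IsQuadrilateral U q r s p

theorem IsQuadrilateralLattice.exists_labelling (hQ : Q.IsQuadrilateralLattice)
    {B : Set Q.vertices} (hB : Q.IsDiagonalClass B) {U : Set ℂ} (hU : U ∈ Q.boundedFaces) :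
    ∃ p q r s, IsLabelling B U p q r s := by
  obtain ⟨z₁, z₂, z₃, z₄, h⟩ := hQ.face_quadrilateral U hU
  rcases hB z₁ z₂ z₃ z₄ ⟨U, hU, h⟩ with ⟨h1, h3, h2, h4⟩ | ⟨h1, h3, h2, h4⟩
  · exact ⟨z₁, z₂, z₃, z₄, h1, h3, h2, h4, Or.inl h⟩
  · exact ⟨z₄, z₁, z₂, z₃, h4, h2, h1, h3, Or.inr h⟩

namespace IsLabelling

variable {B : Set Q.vertices} {U V : Set ℂ} {p q r s p' q' r' s' a b : Q.vertices}

theorem ne_pr (h : IsLabelling B U p q r s) : p ≠ r := by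
  rcases h.quad with h | h
  exacts [h.ne₁₃, h.ne₂₄.symm]

theorem ne_qs (h : IsLabelling B U p q r s) : q ≠ s := by
  rcases h.quad with h | h
  exacts [h.ne₂₄, h.ne₁₃]

theorem adj_of_isSide (h : IsLabelling B U p q r s) (hs : IsSide p q r s a b) :
    Q.graph.Adj a b := by
  rcases h.quad with h | h
  · exact h.adj_of_isSide hs
  · exact h.adj_of_isSide (isSide_rotate (isSide_rotate (isSide_rotate hs)))

theorem isSide (h : IsLabelling B U p q r s) (hU : U ∈ Q.boundedFaces) (hab : Q.graph.Adj a b)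
    {m : ℂ} (hm : m ∈ openSegment ℝ (a : ℂ) b)
    (hr : ∀ᶠ y in 𝓝 m, cross a b y < 0 → y ∈ U) : IsSide p q r s a b := by
  rcases h.quad with h | h
  · exact h.isSide hU hab hm hr
  · exact isSide_rotate (h.isSide hU hab hm hr)

theorem face_eq_of_side (h : IsLabelling B U p q r s) (hU : U ∈ Q.boundedFaces)
    (h' : IsLabelling B V p' q' r' s') (hV : V ∈ Q.boundedFaces)
    (hs : IsSide p q r s a b) (hs' : IsSide p' q' r' s' a b) : U = V := by
  have hab := (h.adj_of_isSide hs).ne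
  have rot : ∀ {p q r s : Q.vertices}, IsSide p q r s a b → IsSide q r s p a b :=
    fun hs => isSide_rotate (isSide_rotate (isSide_rotate hs))
  rcases h.quad with h | h <;> rcases h'.quad with h' | h'
  · exact h.face_eq_of_side hU h' hV hab hs hs'
  · exact h.face_eq_of_side hU h' hV hab hs (rot hs')
  · exact h.face_eq_of_side hU h' hV hab (rot hs) hs'
  · exact h.face_eq_of_side hU h' hV hab (rot hs) (rot hs')

theorem isSide_iff_of_mem (h : IsLabelling B U p q r s) :
    (a ∈ B ∧ IsSide p q r s a b) ↔ (a = p ∧ b = q) ∨ (a = r ∧ b = s) := by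
  constructor
  · rintro ⟨ha, hs⟩
    rcases hs with hs | ⟨rfl, rfl⟩ | hs | ⟨rfl, rfl⟩
    exacts [Or.inl hs, absurd ha h.up_notMem, Or.inr hs, absurd ha h.down_notMem]
  · rintro (⟨rfl, rfl⟩ | ⟨rfl, rfl⟩)
    exacts [⟨h.left_mem, Or.inl ⟨rfl, rfl⟩⟩, ⟨h.right_mem, Or.inr (Or.inr (Or.inl ⟨rfl, rfl⟩))⟩]

theorem isSide_iff_of_mem' (h : IsLabelling B U p q r s) :
    (a ∈ B ∧ IsSide p q r s b a) ↔ (a = r ∧ b = q) ∨ (a = p ∧ b = s) := by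
  constructor
  · rintro ⟨ha, hs⟩
    rcases hs with ⟨rfl, rfl⟩ | hs | ⟨rfl, rfl⟩ | hs
    exacts [absurd ha h.up_notMem, Or.inl hs.symm, absurd ha h.down_notMem, Or.inr hs.symm]
  · rintro (⟨rfl, rfl⟩ | ⟨rfl, rfl⟩)
    exacts [⟨h.right_mem, Or.inr (Or.inl ⟨rfl, rfl⟩)⟩,
      ⟨h.left_mem, Or.inr (Or.inr (Or.inr ⟨rfl, rfl⟩))⟩]

end IsLabelling

/-- A choice of labels for all bounded faces. -/
structure FaceLabelling (Q : PlaneGraph) (B : Set Q.vertices) where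
  /-- the bounded faces -/
  faces : Finset (Set ℂ)
  /-- the first vertex in `B` -/
  p : Set ℂ → Q.vertices
  /-- the first vertex outside `B` -/
  q : Set ℂ → Q.vertices
  /-- the second vertex in `B` -/
  r : Set ℂ → Q.vertices
  /-- the second vertex outside `B` -/
  s : Set ℂ → Q.vertices
  mem_faces : ∀ U, U ∈ faces ↔ U ∈ Q.boundedFaces
  labelling : ∀ U ∈ faces, IsLabelling B U (p U) (q U) (r U) (s U)

/-- The label functions need a default vertex on sets that are not faces. A graph without vertices
is excluded because its boundary would be empty, not a circle. -/
theorem IsQuadrilateralLattice.nonempty_faceLabelling (hQ : Q.IsQuadrilateralLattice)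
    {B : Set Q.vertices} (hB : Q.IsDiagonalClass B) : Nonempty (FaceLabelling Q B) := by
  rcases Q.boundedFaces.eq_empty_or_nonempty with he | ⟨U₀, hU₀⟩
  · rcases isEmpty_or_nonempty Q.vertices with hv | ⟨⟨x⟩⟩
    · exfalso
      obtain ⟨e⟩ := hQ.boundary_simple_closed
      have h1 : Q.carrier = ∅ := by
        ext x; simp only [carrier, Set.mem_union, Set.mem_ofPred_eq, Set.mem_empty_iff_false,
          iff_false]
        rintro (⟨v, -⟩ | ⟨a, -⟩)
        exacts [hv.elim v, hv.elim a]
      have h2 : Q.outerFace = Set.univ := by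
        ext x
        simp only [outerFace, h1, Set.compl_empty, Set.mem_univ, true_and, iff_true,
          Set.mem_ofPred_eq]
        rw [PreconnectedSpace.isPreconnected_univ.connectedComponentIn (Set.mem_univ x)]
        exact NormedSpace.unbounded_univ ℝ ℂ
      have h3 : Q.boundary = ∅ := by rw [boundary, h2, frontier_univ]
      exact (h3 ▸ (Set.Nonempty.ne_empty ⟨_, (e.symm 1).2⟩)) rfl
    · exact ⟨⟨∅, fun _ => x, fun _ => x, fun _ => x, fun _ => x, by simp [he], by simp⟩⟩
  · have h : ∀ U, ∃ z : Q.vertices × Q.vertices × Q.vertices × Q.vertices,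
        U ∈ Q.boundedFaces → IsLabelling B U z.1 z.2.1 z.2.2.1 z.2.2.2 := by
      intro U
      by_cases hU : U ∈ Q.boundedFaces
      · obtain ⟨p, q, r, s, h⟩ := hQ.exists_labelling hB hU
        exact ⟨(p, q, r, s), fun _ => h⟩
      · obtain ⟨p, -⟩ := hQ.exists_labelling hB hU₀
        exact ⟨(p, p, p, p), fun h => absurd h hU⟩
    choose z hz using h
    refine ⟨⟨hQ.finite_boundedFaces.toFinset, fun U => (z U).1, fun U => (z U).2.1,
      fun U => (z U).2.2.1, fun U => (z U).2.2.2, by simp, ?_⟩⟩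
    intro U hU
    exact hz U (by simpa using hU)

namespace FaceLabelling

variable {B : Set Q.vertices} (L : FaceLabelling Q B)

theorem exists_unique_isSide {a b : Q.vertices} (hab : Q.graph.Adj a b)
    (hi : midpoint ℝ (a : ℂ) b ∈ Q.inside) :
    ∃ U ∈ L.faces, IsSide (L.p U) (L.q U) (L.r U) (L.s U) a b ∧
      ∀ V ∈ L.faces, IsSide (L.p V) (L.q V) (L.r V) (L.s V) a b → V = U := by
  have hm := midpoint_mem_openSegment (𝕜 := ℝ) (a : ℂ) (b : ℂ)
  obtain ⟨U, hU, h⟩ := exists_face_right hab hm hi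
  have hU' := (L.mem_faces U).2 hU
  have hs := (L.labelling U hU').isSide hU hab hm h
  exact ⟨U, hU', hs, fun V hV hV' => (L.labelling V hV).face_eq_of_side ((L.mem_faces V).1 hV)
    (L.labelling U hU') hU hV' hs⟩

-- Turns a sum over faces into a sum over directed edges, by uniqueness of the face to the right.
-- The predicate `c` records which end of the edge is required to lie in `B`.
open Classical in
theorem sum_isSide_eq (c : Q.vertices → Q.vertices → Prop) (A : Q.vertices → Q.vertices → ℝ)
    (hA : ∀ a b, Q.graph.Adj a b → c a b → A a b ≠ 0 → midpoint ℝ (a : ℂ) b ∈ Q.inside)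
    (a b : Q.vertices) :
    ∑ U ∈ L.faces, (if c a b ∧ IsSide (L.p U) (L.q U) (L.r U) (L.s U) a b then A a b else 0) =
      if c a b ∧ Q.graph.Adj a b ∧ midpoint ℝ (a : ℂ) b ∈ Q.inside then A a b else 0 := by
  split_ifs with h
  · obtain ⟨U, hU, hs, huniq⟩ := L.exists_unique_isSide h.2.1 h.2.2
    rw [Finset.sum_eq_single_of_mem U hU, if_pos ⟨h.1, hs⟩]
    intro V hV hVU
    exact if_neg fun h' => hVU (huniq V hV h'.2)
  · refine Finset.sum_eq_zero fun U hU => ?_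
    split_ifs with h'
    · have hab := (L.labelling U hU).adj_of_isSide h'.2
      by_contra h0
      exact h ⟨h'.1, hab, hA a b hab h'.1 h0⟩
    · rfl

/-- Discrete Stokes formula: a function on the edges that vanishes on the edges not lying inside the
boundary has zero total circulation. -/
theorem sum_circulation_eq_zero (A : Q.vertices → Q.vertices → ℝ)
    (hA : ∀ b w, Q.graph.Adj b w → A b w ≠ 0 → midpoint ℝ (b : ℂ) w ∈ Q.inside) :
    ∑ U ∈ L.faces, (A (L.p U) (L.q U) - A (L.r U) (L.q U) + A (L.r U) (L.s U)
      - A (L.p U) (L.s U)) = 0 := by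
  classical
  have two : ∀ {p q r s : Q.vertices}, p ≠ r → ∑ a : Q.vertices, ∑ b : Q.vertices,
      (if (a = p ∧ b = q) ∨ (a = r ∧ b = s) then A a b else 0) = A p q + A r s := by
    intro p q r s hpr
    have : ∀ a b : Q.vertices, (if (a = p ∧ b = q) ∨ (a = r ∧ b = s) then A a b else 0) =
        (if a = p then (if b = q then A a b else 0) else 0) +
        (if a = r then (if b = s then A a b else 0) else 0) := by
      intro a b
      by_cases h1 : a = p
      · have h2 : a ≠ r := fun h => hpr (h1.symm.trans h)
        simp [h1, hpr]
      · simp only [h1, false_and, false_or, if_false, zero_add]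
        rw [ite_and]
    simp [this, Finset.sum_add_distrib]
  -- Clockwise, the sides leaving `B` are `p → q` and `r → s`. Each inner edge is such a side of
  -- exactly one face.
  have h1 : ∑ U ∈ L.faces, (A (L.p U) (L.q U) + A (L.r U) (L.s U)) =
      ∑ a : Q.vertices, ∑ b : Q.vertices, if a ∈ B ∧ Q.graph.Adj a b ∧
        midpoint ℝ (a : ℂ) b ∈ Q.inside then A a b else 0 := by
    have := fun a b => L.sum_isSide_eq (fun a _ => a ∈ B) A (fun a b h _ h' => hA a b h h') a b
    rw [Finset.sum_congr rfl fun a _ => Finset.sum_congr rfl fun b _ => (this a b).symm,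
      Finset.sum_congr rfl fun a _ => Finset.sum_comm, Finset.sum_comm]
    refine Finset.sum_congr rfl fun U hU => ?_
    simp only [(L.labelling U hU).isSide_iff_of_mem]
    exact (two (L.labelling U hU).ne_pr).symm
  -- The sides `q → r` and `s → p` enter `B`. They yield the same edge sum through the faces on the
  -- other side of the edges.
  have h2 : ∑ U ∈ L.faces, (A (L.r U) (L.q U) + A (L.p U) (L.s U)) =
      ∑ a : Q.vertices, ∑ b : Q.vertices, if a ∈ B ∧ Q.graph.Adj a b ∧
        midpoint ℝ (a : ℂ) b ∈ Q.inside then A a b else 0 := by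
    have e : ∀ a b : Q.vertices, (if a ∈ B ∧ Q.graph.Adj a b ∧
        midpoint ℝ (a : ℂ) b ∈ Q.inside then A a b else 0) = (if a ∈ B ∧ Q.graph.Adj b a ∧
        midpoint ℝ (b : ℂ) a ∈ Q.inside then A a b else 0) := fun a b => by
      rw [midpoint_comm, Q.graph.adj_comm]
    rw [Finset.sum_congr rfl fun a _ => Finset.sum_congr rfl fun b _ => e a b]
    have := fun a b => L.sum_isSide_eq (fun _ a => a ∈ B) (fun b a => A a b)
      (fun b a h _ h' => by rw [midpoint_comm]; exact hA a b h.symm h') b a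
    beta_reduce at this
    rw [Finset.sum_congr rfl fun a _ => Finset.sum_congr rfl fun b _ => (this a b).symm,
      Finset.sum_congr rfl fun a _ => Finset.sum_comm, Finset.sum_comm]
    refine Finset.sum_congr rfl fun U hU => ?_
    simp only [(L.labelling U hU).isSide_iff_of_mem']
    exact (two (L.labelling U hU).ne_pr.symm).symm
  have h3 := h1.trans h2.symm
  rw [← sub_eq_zero, ← Finset.sum_sub_distrib] at h3
  rw [← h3]
  exact Finset.sum_congr rfl fun U _ => by ring

end FaceLabelling

end PlaneGraph

/-! ### Areas of the faces and negligibility of the graph -/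

open MeasureTheory in
theorem volume_standard_triangle :
    volume {z : ℂ | 0 ≤ z.re ∧ 0 ≤ z.im ∧ z.re + z.im ≤ 1} = ENNReal.ofReal (1 / 2) := by
  set T : Set (ℝ × ℝ) := {z | 0 ≤ z.1 ∧ 0 ≤ z.2 ∧ z.1 + z.2 ≤ 1} with hT
  have hTc : IsClosed T := by
    refine (isClosed_le continuous_const continuous_fst).inter
      ((isClosed_le continuous_const continuous_snd).inter
        (isClosed_le (continuous_fst.add continuous_snd) continuous_const))
  have h1 : {z : ℂ | 0 ≤ z.re ∧ 0 ≤ z.im ∧ z.re + z.im ≤ 1} =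
      Complex.measurableEquivRealProd ⁻¹' T := by
    ext z; simp [hT, Complex.measurableEquivRealProd_apply]
  rw [h1, Complex.volume_preserving_equiv_real_prod.measure_preimage hTc.nullMeasurableSet,
    Measure.volume_eq_prod, Measure.prod_apply hTc.measurableSet]
  have h2 : ∀ x : ℝ, volume (Prod.mk x ⁻¹' T) =
      (Set.Icc (0 : ℝ) 1).indicator (fun x => ENNReal.ofReal (1 - x)) x := by
    intro x
    by_cases hx : x ∈ Set.Icc (0 : ℝ) 1
    · rw [Set.indicator_of_mem hx]
      have : Prod.mk x ⁻¹' T = Set.Icc 0 (1 - x) := by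
        ext y
        simp only [hT, Set.mem_preimage, Set.mem_ofPred_eq, Set.mem_Icc]
        constructor
        · rintro ⟨-, h, h'⟩; exact ⟨h, by linarith⟩
        · rintro ⟨h, h'⟩; exact ⟨hx.1, h, by linarith⟩
      rw [this, Real.volume_Icc, sub_zero]
    · rw [Set.indicator_of_notMem hx]
      have : Prod.mk x ⁻¹' T = ∅ := by
        ext y
        simp only [hT, Set.mem_preimage, Set.mem_ofPred_eq, Set.mem_empty_iff_false, iff_false]
        rintro ⟨h, h', h''⟩; exact hx ⟨h, by linarith⟩
      rw [this, measure_empty]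
  simp only [h2]
  rw [lintegral_indicator measurableSet_Icc, ← ofReal_integral_eq_lintegral_ofReal]
  · rw [integral_Icc_eq_integral_Ioc, ← intervalIntegral.integral_of_le zero_le_one]
    congr 1
    rw [intervalIntegral.integral_sub (by simp) (by simp)]
    simp; norm_num
  · exact (continuous_const.sub continuous_id).continuousOn.integrableOn_Icc
  · exact (ae_restrict_iff' measurableSet_Icc).2 (ae_of_all _ fun x hx => sub_nonneg.2 hx.2)

open MeasureTheory in
theorem volume_triangle {a b c : ℂ} (h : cross a b c < 0) :
    volume (convexHull ℝ ({a, b, c} : Set ℂ)) = ENNReal.ofReal (-(cross a b c) / 2) := by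
  set f : ℂ →ₗ[ℝ] ℂ := Complex.reLm.smulRight (b - a) + Complex.imLm.smulRight (c - a) with hf
  have hfz : ∀ z, f z = z.re • (b - a) + z.im • (c - a) := fun z => rfl
  have hdet : LinearMap.det f = cross a b c := by
    rw [← LinearMap.det_toMatrix Complex.basisOneI, Matrix.det_fin_two]
    simp only [LinearMap.toMatrix_apply, Complex.coe_basisOneI, Complex.coe_basisOneI_repr, hfz]
    simp [cross]
    ring
  have himg : convexHull ℝ ({a, b, c} : Set ℂ) =
      (fun z => a + z) '' (f '' {z : ℂ | 0 ≤ z.re ∧ 0 ≤ z.im ∧ z.re + z.im ≤ 1}) := by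
    ext x
    rw [mem_convexHull_triangle h, Set.image_image]
    have key : ∀ z, cross a b (a + f z) = z.im * cross a b c ∧
        cross b c (a + f z) = (1 - z.re - z.im) * cross a b c ∧
        cross c a (a + f z) = z.re * cross a b c := by
      intro z
      simp only [hfz, cross, Complex.add_re, Complex.add_im, Complex.smul_re, Complex.smul_im,
        smul_eq_mul, Complex.sub_re, Complex.sub_im]
      refine ⟨by ring, by ring, by ring⟩
    constructor
    · rintro ⟨h1, h2, h3⟩
      refine ⟨⟨cross c a x / cross a b c, cross a b x / cross a b c⟩,
        ⟨div_nonneg_of_nonpos h3 h.le, div_nonneg_of_nonpos h1 h.le, ?_⟩, ?_⟩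
      · have e := cross_add_cross_add_cross a b c x
        rw [← add_div, div_le_one_of_neg h]
        linarith
      · beta_reduce
        rw [hfz]
        conv_rhs => rw [← cross_barycentric a b c x h.ne]
        have e := cross_add_cross_add_cross a b c x
        have e' : cross b c x / cross a b c =
            1 - cross c a x / cross a b c - cross a b x / cross a b c := by
          field_simp [h.ne]; linarith
        rw [e']
        module
    · rintro ⟨z, ⟨h1, h2, h3⟩, rfl⟩
      obtain ⟨k1, k2, k3⟩ := key z
      simp only [k1, k2, k3]
      exact ⟨mul_nonpos_of_nonneg_of_nonpos h2 h.le,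
        mul_nonpos_of_nonneg_of_nonpos (by linarith) h.le, mul_nonpos_of_nonneg_of_nonpos h1 h.le⟩
  rw [himg, Set.image_add_left, measure_preimage_add, Measure.addHaar_image_linearMap, hdet,
    volume_standard_triangle, ← ENNReal.ofReal_mul (abs_nonneg _), abs_of_neg h]
  congr 1; ring

-- The line lies in the frontier of a half-plane, and frontiers of convex sets are null.
open MeasureTheory in
theorem volume_cross_eq_zero {a b : ℂ} (hab : a ≠ b) : volume {x | cross a b x = 0} = 0 := by
  have hfr : {x | cross a b x = 0} ⊆ frontier {x | cross a b x ≤ 0} := by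
    intro x hx
    rw [frontier, Set.mem_sdiff]
    refine ⟨subset_closure (le_of_eq hx), fun hi => ?_⟩
    have hx' : cross b a x = 0 := by rw [cross_swap, hx, neg_zero]
    obtain ⟨y, hy, hy'⟩ := PlaneGraph.exists_cross_neg_mem_nhds hab.symm hx'
      (mem_interior_iff_mem_nhds.1 hi)
    rw [cross_swap] at hy'
    have : cross a b y ≤ 0 := hy
    linarith
  exact measure_mono_null hfr ((convex_cross_nonpos a b).addHaar_frontier _)

open MeasureTheory in
theorem volume_interior_quadRegion {a b c d : ℂ} (h₁ : cross a b c < 0) (h₂ : cross a c d < 0) :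
    volume (interior (quadRegion a b c d)) =
      ENNReal.ofReal (-(cross a b c + cross a c d) / 2) := by
  have hac : a ≠ c := by
    rintro rfl
    rw [cross_self_left] at h₁; exact lt_irrefl _ h₁
  set T₁ := convexHull ℝ ({a, b, c} : Set ℂ) with hT₁
  set T₂ := convexHull ℝ ({a, c, d} : Set ℂ) with hT₂
  have hc₁ : IsClosed T₁ := ((Set.toFinite _).isCompact_convexHull ℝ).isClosed
  have hc₂ : IsClosed T₂ := ((Set.toFinite _).isCompact_convexHull ℝ).isClosed
  have hfr : volume (frontier (T₁ ∪ T₂)) = 0 := by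
    refine measure_mono_null (frontier_union_subset T₁ T₂) (measure_union_null ?_ ?_)
    · exact measure_mono_null Set.inter_subset_left ((convex_convexHull ℝ _).addHaar_frontier _)
    · exact measure_mono_null Set.inter_subset_right ((convex_convexHull ℝ _).addHaar_frontier _)
  have hint : volume (interior (quadRegion a b c d)) = volume (T₁ ∪ T₂) := by
    refine le_antisymm (measure_mono interior_subset) ?_
    refine (measure_mono (?_ : _ ⊆ interior (T₁ ∪ T₂) ∪ frontier (T₁ ∪ T₂))).trans
      ((measure_union_le _ _).trans (by rw [hfr, add_zero]; rfl))
    rw [← closure_eq_interior_union_frontier]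
    exact subset_closure
  have hd : AEDisjoint volume T₁ T₂ := by
    refine measure_mono_null ?_ (volume_cross_eq_zero hac)
    rintro x ⟨hx₁, hx₂⟩
    have k₁ := ((mem_convexHull_triangle h₁ x).1 hx₁).2.2
    have k₂ := ((mem_convexHull_triangle h₂ x).1 hx₂).1
    rw [cross_swap] at k₁
    exact le_antisymm k₂ (by linarith)
  rw [hint, measure_union₀ hc₂.measurableSet.nullMeasurableSet hd, volume_triangle h₁,
    volume_triangle h₂, ← ENNReal.ofReal_add (by linarith) (by linarith)]
  congr 1; ring

open MeasureTheory in
theorem PlaneGraph.volume_carrier (Q : PlaneGraph) : volume Q.carrier = 0 := by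
  refine measure_union_null ?_ ?_
  · refine Set.Finite.measure_zero ?_ _
    refine (Set.finite_range fun v : Q.vertices => (v : ℂ)).subset ?_
    rintro x ⟨v, rfl⟩
    exact ⟨v, rfl⟩
  · have : {x | ∃ a b : Q.vertices, Q.graph.Adj a b ∧ x ∈ segment ℝ (a : ℂ) (b : ℂ)} ⊆
        ⋃ a : Q.vertices, ⋃ b : Q.vertices, ⋃ _ : Q.graph.Adj a b,
          {x | cross (a : ℂ) b x = 0} := by
      rintro x ⟨a, b, hab, hx⟩
      simp only [Set.mem_iUnion]
      exact ⟨a, b, hab, cross_eq_zero_of_mem_segment hx⟩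
    refine measure_mono_null this ?_
    simp only [measure_iUnion_null_iff]
    exact fun a b hab => volume_cross_eq_zero (PlaneGraph.coe_ne_of_adj hab)

/-! ### Metric and analytic data of a labelled face -/

namespace PlaneGraph

variable {Q : PlaneGraph}

theorem bddAbove_edgeLength :
    BddAbove {d : ℝ | ∃ a b : Q.vertices, Q.graph.Adj a b ∧ d = dist (a : ℂ) (b : ℂ)} := by
  refine Set.Finite.bddAbove ((Set.finite_range fun z : Q.vertices × Q.vertices =>
    dist (z.1 : ℂ) z.2).subset ?_)
  rintro d ⟨a, b, -, rfl⟩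
  exact ⟨(a, b), rfl⟩

theorem dist_le_maxEdgeLength {a b : Q.vertices} (h : Q.graph.Adj a b) :
    dist (a : ℂ) b ≤ Q.maxEdgeLength :=
  le_csSup bddAbove_edgeLength ⟨a, b, h, rfl⟩

theorem maxEdgeLength_nonneg : 0 ≤ Q.maxEdgeLength :=
  Real.sSup_nonneg (by rintro d ⟨a, b, -, rfl⟩; exact dist_nonneg)

theorem rotation_of_orthogonal {δ η : ℂ} {A : ℝ} (hδ : δ ≠ 0) (ho : inner ℝ δ η = 0)
    (hA : δ.re * η.im - δ.im * η.re = -(2 * A)) :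
    η = -Complex.I * ((2 * A / Complex.normSq δ : ℝ) : ℂ) * δ := by
  have hn : Complex.normSq δ ≠ 0 := fun h => hδ (Complex.normSq_eq_zero.1 h)
  rw [Complex.inner] at ho
  simp only [Complex.mul_re, Complex.conj_re, Complex.conj_im] at ho
  have hk := div_mul_cancel₀ (2 * A) hn
  set k := 2 * A / Complex.normSq δ
  rw [Complex.normSq_apply] at hn hk
  apply Complex.ext
  · simp only [Complex.mul_re, Complex.mul_im, Complex.neg_re, Complex.neg_im, Complex.I_re,
      Complex.I_im, Complex.ofReal_re, Complex.ofReal_im]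
    refine mul_left_cancel₀ hn ?_
    linear_combination δ.re * ho - δ.im * hA - δ.im * hk
  · simp only [Complex.mul_re, Complex.mul_im, Complex.neg_re, Complex.neg_im, Complex.I_re,
      Complex.I_im, Complex.ofReal_re, Complex.ofReal_im]
    refine mul_left_cancel₀ hn ?_
    linear_combination δ.im * ho + δ.re * hA + δ.re * hk

-- For any simple quadrilateral, convex or not, the cross product of the diagonals is twice the
-- signed area. Together with orthogonality and the clockwise order this makes `s - q` the clockwise
-- quarter turn of `r - p`, scaled by the conductance `κ`.
open MeasureTheory in
theorem IsLabelling.exists_rotation (hQ : Q.IsOrthogonalLattice) {B : Set Q.vertices} {U : Set ℂ}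
    {p q r s : Q.vertices} (h : IsLabelling B U p q r s) (hU : U ∈ Q.boundedFaces) :
    ∃ κ : ℝ, 0 ≤ κ ∧ (s : ℂ) - q = -Complex.I * κ * (r - p) ∧
      κ * ‖(r : ℂ) - p‖ ^ 2 = 2 * volume.real U := by
  have hne : (r : ℂ) - p ≠ 0 := sub_ne_zero.2 fun e => h.ne_pr (Subtype.ext e).symm
  have key : inner ℝ ((r : ℂ) - p) (s - q) = 0 ∧ ((r : ℂ) - p).re * ((s : ℂ) - q).im -
      ((r : ℂ) - p).im * ((s : ℂ) - q).re = -(2 * volume.real U) := by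
    rcases h.quad with h | h
    · refine ⟨hQ.orthogonal _ _ _ _ ⟨U, hU, h⟩, ?_⟩
      have h1 := h.cross_left
      have h2 := h.cross_right
      have hv := volume_interior_quadRegion h1 h2
      rw [← h.eq_interior] at hv
      rw [measureReal_def, hv, ENNReal.toReal_ofReal (by linarith)]
      simp only [cross, Complex.sub_re, Complex.sub_im]
      ring
    · have ho := hQ.orthogonal _ _ _ _ ⟨U, hU, h⟩
      rw [real_inner_comm, ← neg_sub, inner_neg_left, neg_eq_zero] at ho
      refine ⟨ho, ?_⟩
      have h1 := h.cross_left
      have h2 := h.cross_right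
      have hv := volume_interior_quadRegion h1 h2
      rw [← h.eq_interior] at hv
      rw [measureReal_def, hv, ENNReal.toReal_ofReal (by linarith)]
      simp only [cross, Complex.sub_re, Complex.sub_im]
      ring
  refine ⟨_, ?_, rotation_of_orthogonal hne key.1 key.2, ?_⟩
  · exact div_nonneg (mul_nonneg zero_le_two measureReal_nonneg) (Complex.normSq_nonneg _)
  · rw [← Complex.normSq_eq_norm_sq]
    exact div_mul_cancel₀ _ fun h => hne (Complex.normSq_eq_zero.1 h)

theorem IsLabelling.analytic {B : Set Q.vertices} {U : Set ℂ} {p q r s : Q.vertices}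
    (h : IsLabelling B U p q r s) (hU : U ∈ Q.boundedFaces) {f : Q.vertices → ℂ}
    (hf : Q.IsDiscreteAnalytic f) :
    (f p - f r) * ((q : ℂ) - s) = (f q - f s) * ((p : ℂ) - r) := by
  have h1 : (p : ℂ) - r ≠ 0 := sub_ne_zero.2 fun e => h.ne_pr (Subtype.ext e)
  have h2 : (q : ℂ) - s ≠ 0 := sub_ne_zero.2 fun e => h.ne_qs (Subtype.ext e)
  rcases h.quad with h | h
  · exact (div_eq_div_iff h1 h2).1 (hf _ _ _ _ ⟨U, hU, h⟩)
  · have h1' : (r : ℂ) - p ≠ 0 := by rw [← neg_sub]; exact neg_ne_zero.2 h1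
    have := (div_eq_div_iff h2 h1').1 (hf _ _ _ _ ⟨U, hU, h⟩)
    linear_combination this

namespace IsLabelling

variable {B : Set Q.vertices} {U : Set ℂ} {p q r s : Q.vertices}

theorem dist_pq (h : IsLabelling B U p q r s) : dist (p : ℂ) q ≤ Q.maxEdgeLength :=
  dist_le_maxEdgeLength (h.adj_of_isSide (Or.inl ⟨rfl, rfl⟩))

theorem dist_qr (h : IsLabelling B U p q r s) : dist (q : ℂ) r ≤ Q.maxEdgeLength :=
  dist_le_maxEdgeLength (h.adj_of_isSide (Or.inr (Or.inl ⟨rfl, rfl⟩)))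

theorem dist_rs (h : IsLabelling B U p q r s) : dist (r : ℂ) s ≤ Q.maxEdgeLength :=
  dist_le_maxEdgeLength (h.adj_of_isSide (Or.inr (Or.inr (Or.inl ⟨rfl, rfl⟩))))

theorem dist_sp (h : IsLabelling B U p q r s) : dist (s : ℂ) p ≤ Q.maxEdgeLength :=
  dist_le_maxEdgeLength (h.adj_of_isSide (Or.inr (Or.inr (Or.inr ⟨rfl, rfl⟩))))

theorem dist_pr (h : IsLabelling B U p q r s) : dist (p : ℂ) r ≤ 2 * Q.maxEdgeLength := by
  have := dist_triangle (p : ℂ) q r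
  linarith [h.dist_pq, h.dist_qr]

theorem subset_closedBall (h : IsLabelling B U p q r s) :
    U ⊆ Metric.closedBall (p : ℂ) (2 * Q.maxEdgeLength) := by
  have h0 : 0 ≤ Q.maxEdgeLength := maxEdgeLength_nonneg
  have hp : (p : ℂ) ∈ Metric.closedBall (p : ℂ) (2 * Q.maxEdgeLength) :=
    Metric.mem_closedBall_self (by linarith)
  have hq : (q : ℂ) ∈ Metric.closedBall (p : ℂ) (2 * Q.maxEdgeLength) := by
    rw [Metric.mem_closedBall, dist_comm]; linarith [h.dist_pq]
  have hr : (r : ℂ) ∈ Metric.closedBall (p : ℂ) (2 * Q.maxEdgeLength) := by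
    rw [Metric.mem_closedBall, dist_comm]; exact h.dist_pr
  have hs : (s : ℂ) ∈ Metric.closedBall (p : ℂ) (2 * Q.maxEdgeLength) := by
    rw [Metric.mem_closedBall]; linarith [h.dist_sp]
  have hc := convex_closedBall (p : ℂ) (2 * Q.maxEdgeLength)
  have hull : ∀ {x y z : ℂ}, x ∈ Metric.closedBall (p : ℂ) (2 * Q.maxEdgeLength) →
      y ∈ Metric.closedBall (p : ℂ) (2 * Q.maxEdgeLength) →
      z ∈ Metric.closedBall (p : ℂ) (2 * Q.maxEdgeLength) →
      convexHull ℝ ({x, y, z} : Set ℂ) ⊆ Metric.closedBall (p : ℂ) (2 * Q.maxEdgeLength) := by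
    intro x y z hx hy hz
    refine convexHull_min ?_ hc
    rintro w (rfl | rfl | rfl) <;> assumption
  rcases h.quad with h | h
  · rw [h.eq_interior]
    exact interior_subset.trans (Set.union_subset (hull hp hq hr) (hull hp hr hs))
  · rw [h.eq_interior]
    exact interior_subset.trans (Set.union_subset (hull hq hr hs) (hull hq hs hp))

end IsLabelling

/-! ### Riemann sums over faces and counting of faces -/

namespace FaceLabelling

variable {B : Set Q.vertices} (L : FaceLabelling Q B)

open Classical in
/-- The faces whose first vertex lies in the given disk. -/
noncomputable def near (x₀ : ℂ) (ρ : ℝ) : Finset (Set ℂ) :=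
  L.faces.filter fun U => (L.p U : ℂ) ∈ Metric.closedBall x₀ ρ

theorem mem_near {x₀ : ℂ} {ρ : ℝ} {U : Set ℂ} :
    U ∈ L.near x₀ ρ ↔ U ∈ L.faces ∧ (L.p U : ℂ) ∈ Metric.closedBall x₀ ρ := by
  simp [near]

theorem disjoint_faces : (L.faces : Set (Set ℂ)).PairwiseDisjoint id := by
  intro U hU V hV hne
  refine Set.disjoint_left.2 fun x hx hx' => hne ?_
  exact boundedFaces_eq_of_mem ((L.mem_faces U).1 hU) ((L.mem_faces V).1 hV) hx hx'

open MeasureTheory in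
theorem measurableSet_face {U : Set ℂ} (hU : U ∈ L.faces) : MeasurableSet U :=
  (isOpen_of_mem_boundedFaces ((L.mem_faces U).1 hU)).measurableSet

open MeasureTheory in
theorem volume_face_ne_top {U : Set ℂ} (hU : U ∈ L.faces) : volume U ≠ ⊤ :=
  ((measure_mono (L.labelling U hU).subset_closedBall).trans_lt measure_closedBall_lt_top).ne

open MeasureTheory in
theorem sum_area_near_le (x₀ : ℂ) (ρ : ℝ) :
    ∑ U ∈ L.near x₀ ρ, volume.real U ≤
      volume.real (Metric.closedBall x₀ (ρ + 2 * Q.maxEdgeLength)) := by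
  have hsub : L.near x₀ ρ ⊆ L.faces := fun U hU => (L.mem_near.1 hU).1
  have hu := measureReal_biUnion_finset (μ := volume) (s := L.near x₀ ρ) (f := id)
    (L.disjoint_faces.subset (by exact_mod_cast hsub))
    (fun U hU => L.measurableSet_face (hsub hU)) (fun U hU => L.volume_face_ne_top (hsub hU))
  simp only [id] at hu
  rw [← hu]
  refine measureReal_mono ?_ measure_closedBall_lt_top.ne
  refine Set.iUnion₂_subset fun U hU => ?_
  refine (L.labelling U (hsub hU)).subset_closedBall.trans (Metric.closedBall_subset_closedBall' ?_)
  have := Metric.mem_closedBall.1 (L.mem_near.1 hU).2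
  linarith

-- The faces cover the support up to the graph, which is null. On each face `ψ` varies by at most
-- `ε`. Faces whose first vertex is farther than two edge lengths from the support contribute
-- nothing to either side.
open MeasureTheory in
theorem abs_sum_area_sub_integral_le {x₀ : ℂ} {R ε : ℝ} {ψ : ℂ → ℝ} (hψ : Continuous ψ)
    (hsupp : ∀ x, ψ x ≠ 0 → x ∈ Metric.closedBall x₀ R)
    (hin : Metric.closedBall x₀ R ⊆ Q.inside)
    (hε : ∀ x y, dist x y ≤ 2 * Q.maxEdgeLength → |ψ x - ψ y| ≤ ε) :
    |∑ U ∈ L.faces, ψ (L.p U) * volume.real U - ∫ x, ψ x| ≤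
      ε * volume.real (Metric.closedBall x₀ (R + 2 * Q.maxEdgeLength + 2 * Q.maxEdgeLength)) := by
  classical
  have h0 : 0 ≤ Q.maxEdgeLength := maxEdgeLength_nonneg
  have hε0 : 0 ≤ ε := by simpa using hε 0 0 (by simpa using h0)
  have hcs : HasCompactSupport ψ :=
    HasCompactSupport.intro (isCompact_closedBall x₀ R) fun x hx => by
      by_contra h; exact hx (hsupp x h)
  have hi : Integrable ψ := hψ.integrable_of_hasCompactSupport hcs
  have hcover : ∫ x, ψ x = ∑ U ∈ L.faces, ∫ x in U, ψ x := by
    have h := integral_biUnion_finset (μ := volume) (f := ψ) L.faces (s := id)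
      (fun U hU => L.measurableSet_face hU) L.disjoint_faces (fun U _ => hi.integrableOn)
    simp only [id] at h
    rw [← h]
    symm
    refine setIntegral_eq_integral_of_ae_compl_eq_zero ?_
    have := measure_eq_zero_iff_ae_notMem.1 Q.volume_carrier
    filter_upwards [this] with x hx hx'
    by_contra hne
    refine hx' ?_
    have hf := connectedComponentIn_mem_boundedFaces (hin (hsupp x hne)) hx
    exact Set.mem_biUnion ((L.mem_faces _).2 hf) (mem_connectedComponentIn hx)
  rw [hcover, ← Finset.sum_sub_distrib]
  have hterm : ∀ U ∈ L.faces, |ψ (L.p U) * volume.real U - ∫ x in U, ψ x| ≤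
      if (L.p U : ℂ) ∈ Metric.closedBall x₀ (R + 2 * Q.maxEdgeLength) then
        ε * volume.real U else 0 := by
    intro U hU
    have hd : ∀ x ∈ U, dist (L.p U : ℂ) x ≤ 2 * Q.maxEdgeLength := fun x hx => by
      rw [dist_comm]; exact (L.labelling U hU).subset_closedBall hx
    split_ifs with hm
    · have e : ψ (L.p U) * volume.real U = ∫ x in U, ψ (L.p U) := by
        rw [setIntegral_const, smul_eq_mul, mul_comm]
      have hc : IntegrableOn (fun _ : ℂ => ψ (L.p U)) U :=
        integrableOn_const (L.volume_face_ne_top hU)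
      rw [e, ← integral_sub hc hi.integrableOn, ← Real.norm_eq_abs]
      exact norm_setIntegral_le_of_norm_le_const (L.volume_face_ne_top hU).lt_top
        fun x hx => hε _ _ (hd x hx)
    · have h1 : ∀ x, dist (L.p U : ℂ) x ≤ 2 * Q.maxEdgeLength → ψ x = 0 := by
        intro x hx
        by_contra hne
        have := Metric.mem_closedBall.1 (hsupp x hne)
        refine hm (Metric.mem_closedBall.2 ?_)
        linarith [dist_triangle (L.p U : ℂ) x x₀]
      rw [h1 _ (by simpa using h0), setIntegral_congr_fun (L.measurableSet_face hU)
        (g := fun _ => (0 : ℝ)) fun x hx => h1 x (hd x hx)]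
      simp
  calc |∑ U ∈ L.faces, (ψ (L.p U) * volume.real U - ∫ x in U, ψ x)|
      ≤ ∑ U ∈ L.faces, |ψ (L.p U) * volume.real U - ∫ x in U, ψ x| :=
        Finset.abs_sum_le_sum_abs _ _
    _ ≤ ∑ U ∈ L.faces, if (L.p U : ℂ) ∈ Metric.closedBall x₀ (R + 2 * Q.maxEdgeLength) then
        ε * volume.real U else 0 := Finset.sum_le_sum hterm
    _ = ε * ∑ U ∈ L.near x₀ (R + 2 * Q.maxEdgeLength), volume.real U := by
        rw [near, Finset.mul_sum, Finset.sum_filter]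
    _ ≤ _ := mul_le_mul_of_nonneg_left (L.sum_area_near_le _ _) hε0

/-- A face is determined by its directed side `p → q`, and for given `p` condition (U) bounds the
number of possible `q`. -/
theorem card_near_le {C : ℝ} (hC : Q.VerticesUniform C) (x₀ : ℂ) (ρ : ℝ) :
    ((L.near x₀ ρ).card : ℝ) ≤
      C * {v : Q.vertices | (v : ℂ) ∈ Metric.closedBall x₀ ρ}.ncard := by
  classical
  set S := {v : Q.vertices | (v : ℂ) ∈ Metric.closedBall x₀ ρ} with hS
  set T : Q.vertices → Finset Q.vertices := fun a =>
    Finset.univ.filter fun b => (b : ℂ) ∈ Metric.closedBall (a : ℂ) Q.maxEdgeLength with hT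
  have hTc : ∀ a, ((T a).card : ℝ) ≤ C := fun a => by
    have := (hC a).le
    rwa [Set.ncard_eq_toFinset_card', Set.toFinset_ofPred] at this
  have h1 : (L.near x₀ ρ).card ≤ (S.toFinset.sigma T).card := by
    refine Finset.card_le_card_of_injOn (fun U => ⟨L.p U, L.q U⟩) ?_ ?_
    · intro U hU
      have hU' := L.mem_near.1 hU
      simp only [Finset.coe_sigma, Set.mem_sigma_iff, Finset.mem_coe, Set.mem_toFinset]
      refine ⟨hU'.2, ?_⟩
      simp only [hT, Finset.mem_filter, Finset.mem_univ, true_and, Metric.mem_closedBall]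
      rw [dist_comm]
      exact (L.labelling U hU'.1).dist_pq
    · intro U hU V hV hUV
      have hU' := (L.mem_near.1 hU).1
      have hV' := (L.mem_near.1 hV).1
      simp only [Sigma.mk.injEq, heq_eq_eq] at hUV
      exact (L.labelling U hU').face_eq_of_side ((L.mem_faces U).1 hU') (L.labelling V hV')
        ((L.mem_faces V).1 hV') (Or.inl ⟨rfl, rfl⟩) (Or.inl hUV)
  rw [Finset.card_sigma] at h1
  rw [Set.ncard_eq_toFinset_card']
  calc ((L.near x₀ ρ).card : ℝ) ≤ ((∑ a ∈ S.toFinset, (T a).card : ℕ) : ℝ) := by exact_mod_cast h1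
    _ = ∑ a ∈ S.toFinset, ((T a).card : ℝ) := by push_cast; rfl
    _ ≤ ∑ a ∈ S.toFinset, C := Finset.sum_le_sum fun a _ => hTc a
    _ = C * S.toFinset.card := by rw [Finset.sum_const, nsmul_eq_mul, mul_comm]

end FaceLabelling

theorem exists_grid_point {h ρ : ℝ} (hh : 0 < h) (x₀ z : ℂ) (hz : z ∈ Metric.closedBall x₀ ρ) :
    ∃ m ∈ Finset.Icc (-((⌈ρ / h⌉₊ : ℤ) + 1)) ((⌈ρ / h⌉₊ : ℤ) + 1),
    ∃ n ∈ Finset.Icc (-((⌈ρ / h⌉₊ : ℤ) + 1)) ((⌈ρ / h⌉₊ : ℤ) + 1),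
      z ∈ Metric.closedBall (x₀ + h * (m + n * Complex.I)) h := by
  rw [Metric.mem_closedBall, dist_eq_norm] at hz
  have bound : ∀ t : ℝ, |t| ≤ ρ → round (t / h) ∈
      Finset.Icc (-((⌈ρ / h⌉₊ : ℤ) + 1)) ((⌈ρ / h⌉₊ : ℤ) + 1) := by
    intro t ht
    have h1 : |t / h| ≤ ρ / h := by rw [abs_div, abs_of_pos hh]; gcongr
    have h2 := abs_sub_round (t / h)
    have h3 := Nat.le_ceil (ρ / h)
    rw [abs_le] at h1 h2
    rw [Finset.mem_Icc]
    constructor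
    · have : (-((⌈ρ / h⌉₊ : ℝ) + 1)) ≤ (round (t / h) : ℝ) := by linarith [h1.1, h2.2]
      exact_mod_cast this
    · have : (round (t / h) : ℝ) ≤ (⌈ρ / h⌉₊ : ℝ) + 1 := by linarith [h1.2, h2.1]
      exact_mod_cast this
  refine ⟨_, bound (z - x₀).re ((Complex.abs_re_le_norm _).trans hz),
    _, bound (z - x₀).im ((Complex.abs_im_le_norm _).trans hz), ?_⟩
  rw [Metric.mem_closedBall, dist_eq_norm]
  -- Rounding each coordinate costs at most `h / 2`, so the distance to the grid point is at most
  -- `h`.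
  have close : ∀ t : ℝ, |t - h * round (t / h)| ≤ h / 2 := by
    intro t
    have h2 := abs_sub_round (t / h)
    have : t - h * round (t / h) = h * (t / h - round (t / h)) := by field_simp
    rw [this, abs_mul, abs_of_pos hh]
    nlinarith
  refine (Complex.norm_le_abs_re_add_abs_im _).trans ?_
  have e1 : (z - (x₀ + h * ((round ((z - x₀).re / h) : ℂ) +
      (round ((z - x₀).im / h) : ℂ) * Complex.I))).re =
      (z - x₀).re - h * round ((z - x₀).re / h) := by
    simp; ring
  have e2 : (z - (x₀ + h * ((round ((z - x₀).re / h) : ℂ) +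
      (round ((z - x₀).im / h) : ℂ) * Complex.I))).im =
      (z - x₀).im - h * round ((z - x₀).im / h) := by
    simp; ring
  rw [e1, e2]
  linarith [close (z - x₀).re, close (z - x₀).im]

/-- The disk is covered by disks of radius `h` centred on a square grid of mesh `h` with `2⌈ρ/h⌉ +
3` points per side. Since `h ≤ 1`, this number times `h` is at most `2ρ + 5`. -/
theorem ncard_vertices_le {C : ℝ} (hC : Q.VerticesUniform C) (x₀ : ℂ) {ρ : ℝ} (hρ : 0 ≤ ρ)
    (hh : 0 < Q.maxEdgeLength) (h1 : Q.maxEdgeLength ≤ 1) :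
    Q.maxEdgeLength ^ 2 * ({v : Q.vertices | (v : ℂ) ∈ Metric.closedBall x₀ ρ}.ncard : ℝ) ≤
      C * (2 * ρ + 5) ^ 2 := by
  classical
  set h := Q.maxEdgeLength with hdef
  have hC0 : 0 < C := (Nat.cast_nonneg _).trans_lt (hC 0)
  set G := Finset.Icc (-((⌈ρ / h⌉₊ : ℤ) + 1)) ((⌈ρ / h⌉₊ : ℤ) + 1) with hG
  set T : ℤ × ℤ → Finset Q.vertices := fun g => Finset.univ.filter fun b =>
    (b : ℂ) ∈ Metric.closedBall (x₀ + h * (g.1 + g.2 * Complex.I)) h with hT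
  have hTc : ∀ a, ((T a).card : ℝ) ≤ C := fun a => by
    have := (hC (x₀ + h * (a.1 + a.2 * Complex.I))).le
    rwa [Set.ncard_eq_toFinset_card', Set.toFinset_ofPred] at this
  have hsub : {v : Q.vertices | (v : ℂ) ∈ Metric.closedBall x₀ ρ}.toFinset ⊆
      (G ×ˢ G).biUnion T := by
    intro v hv
    rw [Set.mem_toFinset] at hv
    obtain ⟨m, hm, n, hn, hmn⟩ := exists_grid_point hh x₀ v hv
    rw [Finset.mem_biUnion]
    exact ⟨(m, n), Finset.mem_product.2 ⟨hm, hn⟩, by simpa [hT] using hmn⟩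
  have hcard : ({v : Q.vertices | (v : ℂ) ∈ Metric.closedBall x₀ ρ}.ncard : ℝ) ≤
      (G.card : ℝ) ^ 2 * C := by
    rw [Set.ncard_eq_toFinset_card']
    calc (({v : Q.vertices | (v : ℂ) ∈ Metric.closedBall x₀ ρ}.toFinset.card : ℕ) : ℝ)
        ≤ ((∑ g ∈ G ×ˢ G, (T g).card : ℕ) : ℝ) := by
          exact_mod_cast (Finset.card_le_card hsub).trans Finset.card_biUnion_le
      _ = ∑ g ∈ G ×ˢ G, ((T g).card : ℝ) := by push_cast; rfl
      _ ≤ ∑ g ∈ G ×ˢ G, C := Finset.sum_le_sum fun a _ => hTc a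
      _ = (G.card : ℝ) ^ 2 * C := by
          rw [Finset.sum_const, Finset.card_product, nsmul_eq_mul]; push_cast; ring
  have hGc : (G.card : ℝ) = 2 * (⌈ρ / h⌉₊ : ℝ) + 3 := by
    rw [hG, Int.card_Icc]
    have : ((⌈ρ / h⌉₊ : ℤ) + 1 + 1 - -((⌈ρ / h⌉₊ : ℤ) + 1)).toNat = 2 * ⌈ρ / h⌉₊ + 3 := by
      omega
    rw [this]; push_cast; ring
  have hceil : h * (⌈ρ / h⌉₊ : ℝ) ≤ ρ + h := by
    have := (Nat.ceil_lt_add_one (div_nonneg hρ hh.le)).le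
    calc h * (⌈ρ / h⌉₊ : ℝ) ≤ h * (ρ / h + 1) := by gcongr
      _ = ρ + h := by field_simp
  have hG2 : h * G.card ≤ 2 * ρ + 5 := by rw [hGc]; linarith
  calc h ^ 2 * ({v : Q.vertices | (v : ℂ) ∈ Metric.closedBall x₀ ρ}.ncard : ℝ)
      ≤ h ^ 2 * ((G.card : ℝ) ^ 2 * C) := by gcongr
    _ = C * (h * G.card) ^ 2 := by ring
    _ ≤ C * (2 * ρ + 5) ^ 2 := by gcongr

theorem FaceLabelling.sq_mul_card_near_le {B : Set Q.vertices} (L : FaceLabelling Q B) {C : ℝ}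
    (hC : Q.VerticesUniform C) (x₀ : ℂ) {ρ : ℝ} (hρ : 0 ≤ ρ) (h1 : Q.maxEdgeLength ≤ 1) :
    Q.maxEdgeLength ^ 2 * ((L.near x₀ ρ).card : ℝ) ≤ C ^ 2 * (2 * ρ + 5) ^ 2 := by
  have hC0 : 0 < C := (Nat.cast_nonneg _).trans_lt (hC 0)
  rcases (maxEdgeLength_nonneg (Q := Q)).eq_or_lt with h0 | h0
  · rw [← h0]; simp only [ne_eq, OfNat.ofNat_ne_zero, not_false_eq_true, zero_pow, zero_mul]
    positivity
  · calc Q.maxEdgeLength ^ 2 * ((L.near x₀ ρ).card : ℝ)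
        ≤ Q.maxEdgeLength ^ 2 *
          (C * {v : Q.vertices | (v : ℂ) ∈ Metric.closedBall x₀ ρ}.ncard) := by
          gcongr; exact L.card_near_le hC x₀ ρ
      _ = C * (Q.maxEdgeLength ^ 2 *
          {v : Q.vertices | (v : ℂ) ∈ Metric.closedBall x₀ ρ}.ncard) := by ring
      _ ≤ C * (C * (2 * ρ + 5) ^ 2) := by
          exact mul_le_mul_of_nonneg_left (ncard_vertices_le hC x₀ hρ h0 h1) hC0.le
      _ = _ := by ring

end PlaneGraph

/-! ### Compact connected subsets of the domain lie inside the lattice boundary -/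

/-- A neighbourhood of `K` of positive width stays in `Ω`, so the boundary of the lattice, being
close to that of `Ω`, eventually misses `K`. A connected set that misses it and has one point inside
is entirely inside. -/
theorem ApproximatesDomain.eventually_subset_inside {Q : ℕ → PlaneGraph} {Ω K : Set ℂ}
    (h : ApproximatesDomain Q Ω) (hΩ : IsOpen Ω) (hK : IsCompact K) (hKc : IsPreconnected K)
    (hKΩ : K ⊆ Ω) {z₀ : ℂ} (hz₀ : z₀ ∈ K) (hin : ∀ᶠ n in atTop, z₀ ∈ (Q n).inside) :
    ∀ᶠ n in atTop, K ⊆ (Q n).inside := by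
  obtain ⟨δ, hδ, hδK⟩ := hK.exists_thickening_subset_open hΩ hKΩ
  filter_upwards [hin, h.boundary_near δ hδ] with n hn hb
  have hd : Disjoint K (Q n).boundary := by
    refine Set.disjoint_left.2 fun z hz hz' => ?_
    obtain ⟨w, hw, hzw⟩ := hb z hz'
    have : w ∈ Ω := hδK (Metric.mem_thickening_iff.2 ⟨z, hz, by rwa [dist_comm]⟩)
    exact (hΩ.frontier_eq ▸ hw).2 this
  by_contra hsub
  obtain ⟨x, hx, hx'⟩ := Set.not_subset.1 hsub
  obtain ⟨y, -, hy, hy'⟩ := hKc (interior (Q n).outerFace) (closure (Q n).outerFace)ᶜ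
    isOpen_interior isClosed_closure.isOpen_compl
    (fun y hy => by
      by_cases hc : y ∈ closure (Q n).outerFace
      · by_cases hi : y ∈ interior (Q n).outerFace
        · exact Or.inl hi
        · exact absurd ⟨hc, hi⟩ (Set.disjoint_left.1 hd hy)
      · exact Or.inr hc)
    ⟨x, hx, by
      by_contra hi
      exact Set.disjoint_left.1 hd hx ⟨not_not.1 hx', hi⟩⟩ ⟨z₀, hz₀, hn⟩
  exact hy' (subset_closure (interior_subset hy))

/-! ### Second-order expansion on a single face -/

/-- The mean value inequality is applied twice, to the derivative and then to `φ` minus its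
quadratic part; symmetry of the Hessian identifies the derivative of that part. -/
theorem taylor_two_bound {φ : ℂ → ℝ} (hφ : ContDiff ℝ 2 φ) {ρ ε : ℝ} (hε : 0 ≤ ε)
    (hH : ∀ x y, ‖x - y‖ ≤ ρ → ‖fderiv ℝ (fderiv ℝ φ) x - fderiv ℝ (fderiv ℝ φ) y‖ ≤ ε)
    {p r : ℂ} (hpr : ‖r - p‖ ≤ ρ) :
    |φ r - φ p - fderiv ℝ φ p (r - p) - fderiv ℝ (fderiv ℝ φ) p (r - p) (r - p) / 2| ≤
      ε * ‖r - p‖ ^ 2 := by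
  set D := fderiv ℝ φ with hD
  set H := fderiv ℝ D with hHd
  have hD1 : ContDiff ℝ 1 D := hφ.fderiv_right (by norm_num)
  have hsymm : ∀ x y, H p x y = H p y x := fun x y =>
    (hφ.contDiffAt.isSymmSndFDerivAt (by simp)).eq x y
  set δ := ‖r - p‖ with hδ
  have hball : ∀ x ∈ Metric.closedBall p δ, ‖x - p‖ ≤ δ := fun x hx => by
    simpa [dist_eq_norm] using hx
  have hpb : p ∈ Metric.closedBall p δ := Metric.mem_closedBall_self (norm_nonneg _)
  have hrb : r ∈ Metric.closedBall p δ := by simp [dist_eq_norm, hδ]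
  have step1 : ∀ x ∈ Metric.closedBall p δ, ‖D x - D p - H p (x - p)‖ ≤ ε * δ := by
    intro x hx
    have h := (convex_closedBall p δ).norm_image_sub_le_of_norm_hasFDerivWithin_le'
      (f := D) (f' := H) (φ := H p) (C := ε) (x := p) (y := x)
      (fun y _ => ((hD1.differentiable one_ne_zero) y).hasFDerivAt.hasFDerivWithinAt)
      (fun y hy => hH y p ((hball y hy).trans hpr)) hpb hx
    exact h.trans (mul_le_mul_of_nonneg_left (hball x hx) hε)
  have hderiv : ∀ y, HasFDerivAt (fun x => φ x - H p (x - p) (x - p) / 2) (D y - H p (y - p)) y := by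
    intro y
    have h1 : HasFDerivAt φ (D y) y := ((hφ.differentiable two_ne_zero) y).hasFDerivAt
    have h0 : HasFDerivAt (fun x : ℂ => x - p) (ContinuousLinearMap.id ℝ ℂ) y :=
      (hasFDerivAt_id y).sub_const p
    have h2 : HasFDerivAt (fun x => H p (x - p)) (H p) y := by
      have := (H p).hasFDerivAt.comp y h0
      rwa [ContinuousLinearMap.comp_id] at this
    have h3 := (h2.clm_apply h0).mul_const (2⁻¹ : ℝ)
    simp only [div_eq_mul_inv]
    refine (h1.sub h3).congr_fderiv ?_
    ext z
    simp [hsymm z]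
    ring
  have h := (convex_closedBall p δ).norm_image_sub_le_of_norm_hasFDerivWithin_le'
    (f := fun x => φ x - H p (x - p) (x - p) / 2) (f' := fun y => D y - H p (y - p)) (φ := D p)
    (C := ε * δ) (x := p) (y := r)
    (fun y _ => (hderiv y).hasFDerivWithinAt)
    (fun y hy => by
      have := step1 y hy
      rwa [sub_right_comm]) hpb hrb
  rw [Real.norm_eq_abs] at h
  calc _ = |φ r - H p (r - p) (r - p) / 2 - (φ p - H p (p - p) (p - p) / 2) - D p (r - p)| := by
        congr 1; simp; ring
    _ ≤ ε * δ * ‖r - p‖ := h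
    _ = ε * δ ^ 2 := by rw [← hδ]; ring

/-- The coefficient of the part of a quadratic form that is the real part of a complex square. -/
noncomputable def conformalCoeff (W : ℂ →L[ℝ] ℂ →L[ℝ] ℝ) : ℂ :=
  ((W 1 Complex.I : ℝ) : ℂ) + Complex.I * ((W 1 1 - W Complex.I Complex.I : ℝ) : ℂ) / 2

theorem norm_conformalCoeff_sub_le (W V : ℂ →L[ℝ] ℂ →L[ℝ] ℝ) :
    ‖conformalCoeff W - conformalCoeff V‖ ≤ 2 * ‖W - V‖ := by
  have hb : ∀ x y : ℂ, ‖x‖ = 1 → ‖y‖ = 1 → |(W - V) x y| ≤ ‖W - V‖ := fun x y hx hy => by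
    simpa [hx, hy] using (W - V).le_opNorm₂ x y
  have e : conformalCoeff W - conformalCoeff V =
      (((W - V) 1 Complex.I : ℝ) : ℂ) +
        Complex.I * (((W - V) 1 1 - (W - V) Complex.I Complex.I : ℝ) : ℂ) / 2 := by
    simp only [conformalCoeff, sub_apply]
    push_cast; ring
  rw [e]
  refine (norm_add_le _ _).trans ?_
  have h1 := hb 1 Complex.I (by simp) (by simp)
  have h2 : |(W - V) 1 1 - (W - V) Complex.I Complex.I| ≤ ‖W - V‖ + ‖W - V‖ :=
    (abs_sub _ _).trans (add_le_add (hb 1 1 (by simp) (by simp)) (hb _ _ (by simp) (by simp)))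
  rw [norm_div, norm_mul, Complex.norm_I, one_mul, Complex.norm_real, Complex.norm_real,
    Real.norm_eq_abs, Real.norm_eq_abs, Complex.norm_ofNat]
  linarith

/-- Write `δ = r - p`. The trace part of `W` sees only `|δ|²`, while the traceless part is the real
part of a constant times `δ²`. As `κδ² = iδ(s - q)` and the circulation of `(b - w)²` is `-2δ(s -
q)`, the traceless part is itself a circulation. -/
theorem quadratic_form_eq (W : ℂ →L[ℝ] ℂ →L[ℝ] ℝ) (hW : ∀ x y, W x y = W y x) {p q r s : ℂ}
    {κ : ℝ} (hrot : s - q = -Complex.I * κ * (r - p)) :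
    κ * W (r - p) (r - p) = (W 1 1 + W Complex.I Complex.I) * (κ * ‖r - p‖ ^ 2 / 2) -
      ((conformalCoeff W * ((p - q) ^ 2 - (r - q) ^ 2 + (r - s) ^ 2 - (p - s) ^ 2)).re) / 2 := by
  have e1 : (p - q) ^ 2 - (r - q) ^ 2 + (r - s) ^ 2 - (p - s) ^ 2 = -2 * ((r - p) * (s - q)) := by
    ring
  rw [e1, hrot]
  set δ := r - p
  have hδ : δ = δ.re • (1 : ℂ) + δ.im • Complex.I := by
    apply Complex.ext <;> simp
  have e2 : W δ δ = δ.re ^ 2 * W 1 1 + 2 * δ.re * δ.im * W 1 Complex.I +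
      δ.im ^ 2 * W Complex.I Complex.I := by
    conv_lhs => rw [hδ]
    simp only [map_add, map_smul, add_apply, smul_apply,
      smul_eq_mul, hW Complex.I 1]
    ring
  rw [e2, ← Complex.normSq_eq_norm_sq, Complex.normSq_apply]
  have e3 : (conformalCoeff W * (-2 * (δ * (-Complex.I * κ * δ)))).re =
      κ * ((W 1 1 - W Complex.I Complex.I) * (δ.im ^ 2 - δ.re ^ 2)
        - 4 * W 1 Complex.I * δ.re * δ.im) := by
    have : conformalCoeff W * (-2 * (δ * (-Complex.I * κ * δ))) =
        (κ : ℂ) * (2 * Complex.I * ((W 1 Complex.I : ℝ) : ℂ) * δ ^ 2 -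
          ((W 1 1 - W Complex.I Complex.I : ℝ) : ℂ) * δ ^ 2) := by
      have hI : Complex.I ^ 2 = -1 := Complex.I_sq
      unfold conformalCoeff
      linear_combination (κ : ℂ) * δ ^ 2 * ((W 1 1 - W Complex.I Complex.I : ℝ) : ℂ) * hI
    rw [this, Complex.re_ofReal_mul, Complex.sub_re, Complex.re_ofReal_mul]
    have : (2 * Complex.I * ((W 1 Complex.I : ℝ) : ℂ) * δ ^ 2).re =
        -4 * W 1 Complex.I * δ.re * δ.im := by
      simp [pow_two]; ring
    rw [this]
    have : (δ ^ 2).re = δ.re ^ 2 - δ.im ^ 2 := by simp [pow_two]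
    rw [this]; ring
  rw [e3]; ring

/-- The two subtracted brackets are circulations and disappear on summation; the last term on the
left is the summand of the Riemann sum. -/
theorem face_estimate {φ : ℂ → ℝ} (hφ : ContDiff ℝ 2 φ) {v : ℂ → ℝ} {p q r s : ℂ}
    {κ area h ε M N up ur : ℝ} (hκ : 0 ≤ κ) (hε : 0 ≤ ε)
    (hrot : s - q = -Complex.I * κ * (r - p)) (harea : κ * ‖r - p‖ ^ 2 = 2 * area)
    (hrq : ‖r - q‖ ≤ h) (hrs : ‖r - s‖ ≤ h) (hpr : ‖r - p‖ ≤ 2 * h)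
    (hH : ∀ x y, ‖x - y‖ ≤ 2 * h → ‖fderiv ℝ (fderiv ℝ φ) x - fderiv ℝ (fderiv ℝ φ) y‖ ≤ ε)
    (hW : ‖v r • fderiv ℝ (fderiv ℝ φ) r - v p • fderiv ℝ (fderiv ℝ φ) p‖ ≤ ε)
    (hup : |up| ≤ M) (hur : |ur| ≤ M) (hvp : |up - v p| ≤ ε) (hvr : |ur - v r| ≤ ε)
    (hNp : ‖fderiv ℝ (fderiv ℝ φ) p‖ ≤ N) (hNr : ‖fderiv ℝ (fderiv ℝ φ) r‖ ≤ N) :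
    |κ * (φ p - φ r) * (up - ur) -
      (up * fderiv ℝ φ p (Complex.I * q) - ur * fderiv ℝ φ r (Complex.I * q) +
        ur * fderiv ℝ φ r (Complex.I * s) - up * fderiv ℝ φ p (Complex.I * s)) -
      ((conformalCoeff (v p • fderiv ℝ (fderiv ℝ φ) p) * (p - q) ^ 2).re / 2 -
        (conformalCoeff (v r • fderiv ℝ (fderiv ℝ φ) r) * (r - q) ^ 2).re / 2 +
        (conformalCoeff (v r • fderiv ℝ (fderiv ℝ φ) r) * (r - s) ^ 2).re / 2 -
        (conformalCoeff (v p • fderiv ℝ (fderiv ℝ φ) p) * (p - s) ^ 2).re / 2) +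
      v p * (fderiv ℝ (fderiv ℝ φ) p 1 1 + fderiv ℝ (fderiv ℝ φ) p Complex.I Complex.I) * area| ≤
      ε * ((4 * M + 2 * N + 1) * area + 2 * h ^ 2) := by
  have hsymm : ∀ z x y, fderiv ℝ (fderiv ℝ φ) z x y = fderiv ℝ (fderiv ℝ φ) z y x := fun z x y =>
    (hφ.contDiffAt.isSymmSndFDerivAt (by simp)).eq x y
  have t1 := taylor_two_bound hφ hε hH hpr
  have t2 := taylor_two_bound hφ hε hH (p := r) (r := p) (by rwa [norm_sub_rev])
  set D := fderiv ℝ φ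
  set H := fderiv ℝ D
  have hneg : H r (p - r) (p - r) = H r (r - p) (r - p) := by
    rw [← neg_sub r p, map_neg, map_neg, neg_apply, neg_neg]
  rw [hneg, norm_sub_rev p r] at t2
  have hquad := quadratic_form_eq (v p • H p)
    (fun x y => by simp only [smul_apply, hsymm p x y]) hrot
  rw [harea] at hquad
  simp only [smul_apply, smul_eq_mul] at hquad
  set δ := r - p with hδ
  set σp := conformalCoeff (v p • H p)
  set σr := conformalCoeff (v r • H r)
  set e1 := φ r - φ p - D p δ - H p δ δ / 2 with he1
  set e2 := φ p - φ r - D r (p - r) - H r δ δ / 2 with he2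
  -- Multiplication by `i` undoes the quarter turn, which makes the first-order term a difference
  -- between `s` and `q`.
  have hDp : D p (Complex.I * s) - D p (Complex.I * q) = κ * D p δ := by
    rw [← map_sub, ← mul_sub, hrot]
    have : Complex.I * (-Complex.I * κ * δ) = κ • δ := by
      rw [Complex.real_smul]
      linear_combination -(κ : ℂ) * δ * Complex.I_sq
    rw [this, map_smul, smul_eq_mul]
  have hDr : D r (Complex.I * s) - D r (Complex.I * q) = -κ * D r (p - r) := by
    rw [← map_sub, ← mul_sub, hrot]
    have : Complex.I * (-Complex.I * κ * δ) = (-κ) • (p - r) := by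
      rw [Complex.real_smul, hδ]; push_cast
      linear_combination -(κ : ℂ) * (r - p) * Complex.I_sq
    rw [this, map_smul, smul_eq_mul]
  -- Six errors remain: the Taylor remainders at `p` and `r`, the replacement of `up` and `ur` by
  -- values of `v` in the second-order terms, the change of the weighted Hessian from `r` to `p`,
  -- and the change of its conformal coefficient.
  have hcalc : κ * (φ p - φ r) * (up - ur) -
      (up * D p (Complex.I * q) - ur * D r (Complex.I * q) +
        ur * D r (Complex.I * s) - up * D p (Complex.I * s)) -
      ((σp * (p - q) ^ 2).re / 2 - (σr * (r - q) ^ 2).re / 2 + (σr * (r - s) ^ 2).re / 2 -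
        (σp * (p - s) ^ 2).re / 2) +
      v p * (H p 1 1 + H p Complex.I Complex.I) * area =
      -(up * (κ * e1)) - ur * (κ * e2) - (up - v p) * (κ * H p δ δ) / 2
        - (ur - v r) * (κ * H r δ δ) / 2
        - κ * (v r • H r - v p • H p) δ δ / 2
        + ((σr - σp) * ((r - q) ^ 2 - (r - s) ^ 2)).re / 2 := by
    have x1 : (σp * ((p - q) ^ 2 - (r - q) ^ 2 + (r - s) ^ 2 - (p - s) ^ 2)).re =
        (σp * (p - q) ^ 2).re - (σp * (r - q) ^ 2).re + (σp * (r - s) ^ 2).re -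
          (σp * (p - s) ^ 2).re := by
      simp only [← Complex.sub_re, ← Complex.add_re]; congr 1; ring
    have x2 : ((σr - σp) * ((r - q) ^ 2 - (r - s) ^ 2)).re = (σr * (r - q) ^ 2).re -
        (σr * (r - s) ^ 2).re - (σp * (r - q) ^ 2).re + (σp * (r - s) ^ 2).re := by
      simp only [← Complex.sub_re, ← Complex.add_re]; congr 1; ring
    rw [x1] at hquad
    rw [x2, he1, he2]
    simp only [sub_apply, smul_apply, smul_eq_mul]
    linear_combination up * hDp - ur * hDr - hquad
  rw [hcalc]
  have harea0 : 0 ≤ area := by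
    have : 0 ≤ κ * ‖δ‖ ^ 2 := by positivity
    linarith
  have hM : 0 ≤ M := (abs_nonneg _).trans hup
  have hN : 0 ≤ N := (norm_nonneg (H p)).trans hNp
  have hform : ∀ (W : ℂ →L[ℝ] ℂ →L[ℝ] ℝ) (K : ℝ), ‖W‖ ≤ K → |κ * W δ δ| ≤ K * (2 * area) := by
    intro W K hWK
    rw [abs_mul, abs_of_nonneg hκ, ← harea]
    have h1 : |W δ δ| ≤ K * ‖δ‖ * ‖δ‖ := (W.le_opNorm₂ δ δ).trans (by gcongr)
    calc κ * |W δ δ| ≤ κ * (K * ‖δ‖ * ‖δ‖) := by gcongr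
      _ = K * (κ * ‖δ‖ ^ 2) := by ring
  have herr : ∀ e : ℝ, |e| ≤ ε * ‖δ‖ ^ 2 → |κ * e| ≤ ε * (2 * area) := by
    intro e he
    rw [abs_mul, abs_of_nonneg hκ, ← harea]
    calc κ * |e| ≤ κ * (ε * ‖δ‖ ^ 2) := by gcongr
      _ = ε * (κ * ‖δ‖ ^ 2) := by ring
  have b1 : |up * (κ * e1)| ≤ M * (ε * (2 * area)) := by
    rw [abs_mul]; exact mul_le_mul hup (herr _ t1) (abs_nonneg _) hM
  have b2 : |ur * (κ * e2)| ≤ M * (ε * (2 * area)) := by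
    rw [abs_mul]; exact mul_le_mul hur (herr _ t2) (abs_nonneg _) hM
  have b3 : |(up - v p) * (κ * H p δ δ)| ≤ ε * (N * (2 * area)) := by
    rw [abs_mul]; exact mul_le_mul hvp (hform _ _ hNp) (abs_nonneg _) hε
  have b4 : |(ur - v r) * (κ * H r δ δ)| ≤ ε * (N * (2 * area)) := by
    rw [abs_mul]; exact mul_le_mul hvr (hform _ _ hNr) (abs_nonneg _) hε
  have b5 := hform _ _ hW
  have b6 : |((σr - σp) * ((r - q) ^ 2 - (r - s) ^ 2)).re| ≤ (2 * ε) * (h ^ 2 + h ^ 2) := by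
    refine (Complex.abs_re_le_norm _).trans ?_
    rw [norm_mul]
    refine mul_le_mul ((norm_conformalCoeff_sub_le _ _).trans (by linarith)) ?_ (norm_nonneg _)
      (by linarith)
    refine (norm_sub_le _ _).trans ?_
    rw [norm_pow, norm_pow]
    gcongr
  rw [abs_le] at b1 b2 b3 b4 b5 b6 ⊢
  constructor <;> linarith [b1.1, b1.2, b2.1, b2.2, b3.1, b3.2, b4.1, b4.2, b5.1, b5.2, b6.1, b6.2]

/-! ### Summation over all faces and weak harmonicity of the limit -/

theorem fderiv_eq_zero_of_eq_zero_off {E : Type*} [NormedAddCommGroup E] [NormedSpace ℝ E]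
    {f : ℂ → E} {K : Set ℂ} (hK : IsClosed K) (hf : ∀ x ∉ K, f x = 0) {x : ℂ} (hx : x ∉ K) :
    fderiv ℝ f x = 0 := by
  have : f =ᶠ[𝓝 x] fun _ => 0 := by
    filter_upwards [hK.isOpen_compl.mem_nhds hx] with y hy using hf y hy
  rw [this.fderiv_eq]; simp

theorem IsOpen.continuous_smul_of_eq_zero_off {E : Type*} [NormedAddCommGroup E] [NormedSpace ℝ E]
    {Ω K : Set ℂ} (hΩ : IsOpen Ω) (hK : IsClosed K) (hKΩ : K ⊆ Ω) {v : ℂ → ℝ}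
    (hv : ContinuousOn v Ω) {f : ℂ → E} (hf : Continuous f) (hf0 : ∀ x ∉ K, f x = 0) :
    Continuous fun x => v x • f x := by
  rw [continuous_iff_continuousAt]
  intro x
  by_cases hx : x ∈ Ω
  · exact (hv.continuousAt (hΩ.mem_nhds hx)).smul hf.continuousAt
  · have hx' : x ∉ K := fun h => hx (hKΩ h)
    have : (fun _ => (0 : E)) =ᶠ[𝓝 x] fun x => v x • f x := by
      filter_upwards [hK.isOpen_compl.mem_nhds hx'] with y hy
      rw [hf0 y hy, smul_zero]
    exact continuousAt_const.congr this

theorem conformalCoeff_zero : conformalCoeff 0 = 0 := by simp [conformalCoeff]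

open MeasureTheory in
theorem PlaneGraph.FaceLabelling.abs_integral_laplacian_le {Q : PlaneGraph}
    (hQ : Q.IsOrthogonalLattice) {B : Set Q.vertices} (L : Q.FaceLabelling B) {C : ℝ}
    (hC : Q.VerticesUniform C) {u : Q.vertices → ℝ} (hu : Q.IsDiscreteHarmonic u)
    {φ : ℂ → ℝ} (hφ : ContDiff ℝ 2 φ) {v : ℂ → ℝ} {x₀ : ℂ} {R₀ R₁ ε M N : ℝ}
    (hR₀ : 0 ≤ R₀) (hε : 0 ≤ ε) (hM : 0 ≤ M) (hN : 0 ≤ N)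
    (hsupp : ∀ x ∉ Metric.closedBall x₀ R₀, φ x = 0)
    (hR : R₀ + 4 * Q.maxEdgeLength ≤ R₁) (h1 : Q.maxEdgeLength ≤ 1)
    (hin : Metric.closedBall x₀ R₁ ⊆ Q.inside)
    (hH : ∀ x y, ‖x - y‖ ≤ 2 * Q.maxEdgeLength →
      ‖fderiv ℝ (fderiv ℝ φ) x - fderiv ℝ (fderiv ℝ φ) y‖ ≤ ε)
    (hWc : Continuous fun x => v x • fderiv ℝ (fderiv ℝ φ) x)
    (hW : ∀ x y, ‖x - y‖ ≤ 2 * Q.maxEdgeLength →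
      ‖v x • fderiv ℝ (fderiv ℝ φ) x - v y • fderiv ℝ (fderiv ℝ φ) y‖ ≤ ε)
    (huM : ∀ b ∈ B, (b : ℂ) ∈ Metric.closedBall x₀ R₁ → |u b| ≤ M ∧ |u b - v b| ≤ ε)
    (hHN : ∀ x, ‖fderiv ℝ (fderiv ℝ φ) x‖ ≤ N) :
    |∫ z, v z * (fderiv ℝ (fderiv ℝ φ) z 1 1 + fderiv ℝ (fderiv ℝ φ) z Complex.I Complex.I)| ≤
      ε * ((4 * M + 2 * N + 1) * volume.real (Metric.closedBall x₀ R₁) +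
        2 * (C ^ 2 * (2 * R₁ + 5) ^ 2) + 2 * volume.real (Metric.closedBall x₀ R₁)) := by
  classical
  set h := Q.maxEdgeLength with hh
  have h0 : 0 ≤ h := maxEdgeLength_nonneg
  set D := fderiv ℝ φ with hD
  set H := fderiv ℝ D with hHd
  set K := Metric.closedBall x₀ R₀ with hK
  have hKc : IsClosed K := Metric.isClosed_closedBall
  have hD0 : ∀ x ∉ K, D x = 0 := fun x hx => fderiv_eq_zero_of_eq_zero_off hKc hsupp hx
  have hH0 : ∀ x ∉ K, H x = 0 := fun x hx => fderiv_eq_zero_of_eq_zero_off hKc hD0 hx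
  set ψ : ℂ → ℝ := fun z => v z * (H z 1 1 + H z Complex.I Complex.I) with hψ
  have hψW : ∀ z, ψ z = (v z • H z) 1 1 + (v z • H z) Complex.I Complex.I := fun z => by
    simp only [hψ, smul_apply, smul_eq_mul]; ring
  have hψc : Continuous ψ := by
    have : ψ = fun z => (v z • H z) 1 1 + (v z • H z) Complex.I Complex.I := funext hψW
    rw [this]
    exact ((hWc.clm_apply continuous_const).clm_apply continuous_const).add
      ((hWc.clm_apply continuous_const).clm_apply continuous_const)
  have hψ0 : ∀ x, ψ x ≠ 0 → x ∈ K := fun x hx => by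
    by_contra hxK
    exact hx (by simp [hψ, hH0 x hxK])
  have hKR : K ⊆ Metric.closedBall x₀ R₁ := Metric.closedBall_subset_closedBall (by linarith)
  have hψε : ∀ x y, dist x y ≤ 2 * h → |ψ x - ψ y| ≤ 2 * ε := by
    intro x y hxy
    rw [dist_eq_norm] at hxy
    have hn := hW x y hxy
    have hb : ∀ e : ℂ, ‖e‖ = 1 → |(v x • H x - v y • H y) e e| ≤ ε := fun e he => by
      have := (v x • H x - v y • H y).le_opNorm₂ e e
      rw [he, mul_one, mul_one] at this
      exact this.trans hn
    have e : ψ x - ψ y = (v x • H x - v y • H y) 1 1 +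
        (v x • H x - v y • H y) Complex.I Complex.I := by
      rw [hψW, hψW]; simp only [sub_apply]; ring
    rw [e]
    refine (abs_add_le _ _).trans ?_
    linarith [hb 1 (by simp), hb Complex.I (by simp)]
  -- Supplies the hypothesis of the Stokes formula: edges that carry a nonzero value start in the
  -- support, and the margin between the radii keeps their midpoints inside.
  have hmid : ∀ b w : Q.vertices, Q.graph.Adj b w → (b : ℂ) ∈ K →
      midpoint ℝ (b : ℂ) w ∈ Q.inside := by
    intro b w hbw hb
    refine hin (Metric.mem_closedBall.2 ?_)
    have h2 : dist (midpoint ℝ (b : ℂ) w) b ≤ h := by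
      rw [dist_midpoint_left]
      have := dist_le_maxEdgeLength hbw
      have := dist_nonneg (x := (b : ℂ)) (y := w)
      rw [Real.norm_eq_abs, abs_of_pos (by norm_num)]
      linarith
    have := Metric.mem_closedBall.1 hb
    linarith [dist_triangle (midpoint ℝ (b : ℂ) w) b x₀]
  obtain ⟨f, hf, huf⟩ := hu
  have hrot : ∀ U ∈ L.faces, ∃ κ : ℝ, 0 ≤ κ ∧
      (L.s U : ℂ) - L.q U = -Complex.I * κ * (L.r U - L.p U) ∧
      κ * ‖(L.r U : ℂ) - L.p U‖ ^ 2 = 2 * volume.real U := fun U hU =>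
    (L.labelling U hU).exists_rotation hQ ((L.mem_faces U).1 hU)
  choose! κ hκ0 hκr hκa using hrot
  -- The discrete Cauchy–Riemann equation: imaginary part of the analyticity relation after dividing
  -- out `p - r`.
  have hconj : ∀ U ∈ L.faces, κ U * (u (L.p U) - u (L.r U)) =
      (f (L.s U)).im - (f (L.q U)).im := by
    intro U hU
    have ha := (L.labelling U hU).analytic ((L.mem_faces U).1 hU) hf
    have hne : (L.p U : ℂ) - L.r U ≠ 0 := sub_ne_zero.2 fun e =>
      (L.labelling U hU).ne_pr (Subtype.ext e)
    have e1 : (L.q U : ℂ) - L.s U = -Complex.I * κ U * (L.p U - L.r U) := by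
      linear_combination -hκr U hU
    rw [e1, ← mul_assoc] at ha
    have := mul_right_cancel₀ hne ha
    have e2 := congrArg Complex.im this
    simp only [Complex.sub_im, Complex.mul_im, Complex.mul_re, Complex.neg_re, Complex.neg_im,
      Complex.I_re, Complex.I_im, Complex.ofReal_re, Complex.ofReal_im, Complex.sub_re] at e2
    rw [huf, huf]
    linarith
  set A₁ : Q.vertices → Q.vertices → ℝ := fun b w => u b * D b (Complex.I * w) with hA₁
  set A₂ : Q.vertices → Q.vertices → ℝ := fun b w =>
    (conformalCoeff (v b • H b) * ((b : ℂ) - w) ^ 2).re / 2 with hA₂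
  set circ : (Q.vertices → Q.vertices → ℝ) → Set ℂ → ℝ := fun A U =>
    A (L.p U) (L.q U) - A (L.r U) (L.q U) + A (L.r U) (L.s U) - A (L.p U) (L.s U) with hcirc
  have hσ0 : ∀ x ∉ K, conformalCoeff (v x • H x) = 0 := fun x hx => by
    rw [hH0 x hx, smul_zero, conformalCoeff_zero]
  have s1 : ∑ U ∈ L.faces, circ A₁ U = 0 := L.sum_circulation_eq_zero A₁ fun b w hbw hne => by
    refine hmid b w hbw ?_
    by_contra hb
    exact hne (by simp [hA₁, hD0 _ hb])
  have s2 : ∑ U ∈ L.faces, circ A₂ U = 0 := L.sum_circulation_eq_zero A₂ fun b w hbw hne => by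
    refine hmid b w hbw ?_
    by_contra hb
    exact hne (by simp [hA₂, hσ0 _ hb])
  -- Summation by parts, with the conjugate function `Im f` on the white vertices.
  have s0 : ∑ U ∈ L.faces, κ U * (φ (L.p U) - φ (L.r U)) * (u (L.p U) - u (L.r U)) = 0 := by
    have := L.sum_circulation_eq_zero (fun b w => φ b * (f w).im) fun b w hbw hne => by
      refine hmid b w hbw ?_
      by_contra hb
      exact hne (by simp [hsupp _ hb])
    rw [← neg_eq_zero, ← Finset.sum_neg_distrib, ← this]
    refine Finset.sum_congr rfl fun U hU => ?_
    linear_combination -(φ (L.p U) - φ (L.r U)) * hconj U hU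
  set X : Set ℂ → ℝ := fun U => κ U * (φ (L.p U) - φ (L.r U)) * (u (L.p U) - u (L.r U)) -
    circ A₁ U - circ A₂ U + ψ (L.p U) * volume.real U with hX
  have hsum : ∑ U ∈ L.faces, X U = ∑ U ∈ L.faces, ψ (L.p U) * volume.real U := by
    simp only [hX, Finset.sum_add_distrib, Finset.sum_sub_distrib, s0, s1, s2]; ring
  -- Beyond radius `R₀ + 2h` neither `p` nor `r` is in the support, so every term vanishes.
  have hXb : ∀ U ∈ L.faces, |X U| ≤ if (L.p U : ℂ) ∈ Metric.closedBall x₀ (R₀ + 2 * h) then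
      ε * ((4 * M + 2 * N + 1) * volume.real U + 2 * h ^ 2) else 0 := by
    intro U hU
    have hl := L.labelling U hU
    have hpr := hl.dist_pr
    have hrp : ‖(L.r U : ℂ) - L.p U‖ ≤ 2 * h := by rw [← dist_eq_norm, dist_comm]; exact hpr
    split_ifs with hp
    · have hp' := Metric.mem_closedBall.1 hp
      have hpR : (L.p U : ℂ) ∈ Metric.closedBall x₀ R₁ := Metric.mem_closedBall.2 (by linarith)
      have hrR : (L.r U : ℂ) ∈ Metric.closedBall x₀ R₁ := Metric.mem_closedBall.2 (by
        have := dist_triangle (L.r U : ℂ) (L.p U) x₀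
        rw [dist_comm (L.r U : ℂ) (L.p U : ℂ)] at this
        linarith)
      obtain ⟨m1, m2⟩ := huM _ hl.left_mem hpR
      obtain ⟨m3, m4⟩ := huM _ hl.right_mem hrR
      exact face_estimate hφ (hκ0 U hU) hε (hκr U hU) (hκa U hU)
        (by rw [← dist_eq_norm, dist_comm]; exact hl.dist_qr)
        (by rw [← dist_eq_norm]; exact hl.dist_rs) hrp hH (hW _ _ hrp) m1 m3 m2 m4 (hHN _) (hHN _)
    · have hpK : (L.p U : ℂ) ∉ K := fun hk => hp (Metric.closedBall_subset_closedBall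
        (by linarith) hk)
      have hrK : (L.r U : ℂ) ∉ K := fun hk => hp (Metric.mem_closedBall.2 (by
        have := dist_triangle (L.p U : ℂ) (L.r U) x₀
        have := Metric.mem_closedBall.1 hk
        linarith))
      simp [hX, hcirc, hA₁, hA₂, hψ, hsupp _ hpK, hsupp _ hrK, hD0 _ hpK, hD0 _ hrK, hH0 _ hpK,
        hH0 _ hrK, conformalCoeff_zero]
  have hV0 : 0 ≤ volume.real (Metric.closedBall x₀ R₁) := measureReal_nonneg
  have hbound : |∑ U ∈ L.faces, ψ (L.p U) * volume.real U| ≤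
      ε * ((4 * M + 2 * N + 1) * volume.real (Metric.closedBall x₀ R₁) +
        2 * (C ^ 2 * (2 * R₁ + 5) ^ 2)) := by
    rw [← hsum]
    calc |∑ U ∈ L.faces, X U| ≤ ∑ U ∈ L.faces, |X U| := Finset.abs_sum_le_sum_abs _ _
      _ ≤ _ := Finset.sum_le_sum hXb
      _ = ε * ((4 * M + 2 * N + 1) * ∑ U ∈ L.near x₀ (R₀ + 2 * h), volume.real U +
          2 * (h ^ 2 * (L.near x₀ (R₀ + 2 * h)).card)) := by
        rw [← Finset.sum_filter, ← Finset.mul_sum, Finset.sum_add_distrib, ← Finset.mul_sum,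
          Finset.sum_const, nsmul_eq_mul]
        simp only [near]
        ring
      _ ≤ _ := by
        have a1 := L.sum_area_near_le x₀ (R₀ + 2 * h)
        have a2 : volume.real (Metric.closedBall x₀ (R₀ + 2 * h + 2 * h)) ≤
            volume.real (Metric.closedBall x₀ R₁) :=
          measureReal_mono (Metric.closedBall_subset_closedBall (by linarith))
            measure_closedBall_lt_top.ne
        have a3 := L.sq_mul_card_near_le hC x₀ (ρ := R₀ + 2 * h) (by linarith) h1
        have a4 : C ^ 2 * (2 * (R₀ + 2 * h) + 5) ^ 2 ≤ C ^ 2 * (2 * R₁ + 5) ^ 2 := by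
          gcongr; linarith
        have a5 := a1.trans a2
        have a6 := a3.trans a4
        gcongr
  have harea := L.abs_sum_area_sub_integral_le hψc hψ0 (hKR.trans hin) hψε
  have a2 : volume.real (Metric.closedBall x₀ (R₀ + 2 * h + 2 * h)) ≤
      volume.real (Metric.closedBall x₀ R₁) :=
    measureReal_mono (Metric.closedBall_subset_closedBall (by linarith))
      measure_closedBall_lt_top.ne
  have harea' := harea.trans (mul_le_mul_of_nonneg_left a2 (by linarith))
  rw [abs_le] at hbound harea' ⊢
  constructor <;> linarith [hbound.1, hbound.2, harea'.1, harea'.2]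

open MeasureTheory in
theorem integral_mul_laplacian_eq_zero
    {Ω : Set ℂ} (hΩo : IsOpen Ω) (hΩc : IsConnected Ω)
    {Q : ℕ → PlaneGraph} (hQ : ∀ n, (Q n).IsOrthogonalLattice)
    (hND : NondegenerateUniform Q)
    (happrox : ApproximatesDomain Q Ω)
    (hinside : ∃ z₀ ∈ Ω, ∀ᶠ n in atTop, z₀ ∈ (Q n).inside)
    {B : ∀ n, Set (Q n).vertices} (hB : ∀ n, (Q n).IsDiagonalClass (B n))
    {u : ∀ n, (Q n).vertices → ℝ} (hu : ∀ n, (Q n).IsDiscreteHarmonic (u n))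
    {v : ℂ → ℝ} (hv : ContinuousOn v Ω)
    (hconv : ∀ ε > 0, ∀ᶠ n in atTop, ∀ z ∈ B n, (z : ℂ) ∈ Ω → |u n z - v z| < ε)
    {x₀ : ℂ} {R₀ R₁ : ℝ} (hR₀ : 0 ≤ R₀) (hR : R₀ < R₁) (hball : Metric.closedBall x₀ R₁ ⊆ Ω)
    {φ : ℂ → ℝ} (hφ : ContDiff ℝ 2 φ) (hsupp : ∀ x ∉ Metric.closedBall x₀ R₀, φ x = 0) :
    ∫ z, v z * (fderiv ℝ (fderiv ℝ φ) z 1 1 + fderiv ℝ (fderiv ℝ φ) z Complex.I Complex.I) = 0 := by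
  obtain ⟨z₀, hz₀, hin⟩ := hinside
  obtain ⟨C, hC⟩ := hND
  set K := Metric.closedBall x₀ R₀ with hK
  have hKc : IsClosed K := Metric.isClosed_closedBall
  have hx₀ : x₀ ∈ Metric.closedBall x₀ R₁ := Metric.mem_closedBall_self (by linarith)
  -- A path in `Ω` from `z₀` to the centre, together with the ball, is a compact connected set to
  -- which the inclusion criterion applies.
  have hinball : ∀ᶠ n in atTop, Metric.closedBall x₀ R₁ ⊆ (Q n).inside := by
    obtain ⟨γ, hγ⟩ := (hΩo.isConnected_iff_isPathConnected.1 hΩc).joinedIn z₀ hz₀ x₀ (hball hx₀)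
    have hpc : IsPreconnected (Set.range γ ∪ Metric.closedBall x₀ R₁) :=
      IsPreconnected.union x₀ ⟨1, γ.target⟩ hx₀ (isPreconnected_range γ.continuous)
        (convex_closedBall x₀ R₁).isPreconnected
    have hsub : Set.range γ ∪ Metric.closedBall x₀ R₁ ⊆ Ω :=
      Set.union_subset (Set.range_subset_iff.2 hγ) hball
    filter_upwards [happrox.eventually_subset_inside hΩo
      ((isCompact_range γ.continuous).union (isCompact_closedBall x₀ R₁)) hpc hsub
      (Or.inl ⟨0, γ.source⟩) hin] with n hn
    exact Set.subset_union_right.trans hn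
  set D := fderiv ℝ φ with hD
  set H := fderiv ℝ D with hHd
  have hD0 : ∀ x ∉ K, D x = 0 := fun x hx => fderiv_eq_zero_of_eq_zero_off hKc hsupp hx
  have hH0 : ∀ x ∉ K, H x = 0 := fun x hx => fderiv_eq_zero_of_eq_zero_off hKc hD0 hx
  have hHc : Continuous H :=
    (hφ.fderiv_right (m := 1) (by norm_num)).continuous_fderiv one_ne_zero
  have hWc : Continuous fun x => v x • H x :=
    hΩo.continuous_smul_of_eq_zero_off (E := ℂ →L[ℝ] ℂ →L[ℝ] ℝ) hKc
      ((Metric.closedBall_subset_closedBall hR.le).trans hball) hv hHc hH0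
  have hcpt : IsCompact K := isCompact_closedBall x₀ R₀
  have hHs : HasCompactSupport H := HasCompactSupport.intro hcpt hH0
  have hWs : HasCompactSupport fun x => v x • H x :=
    HasCompactSupport.intro hcpt fun x hx => by simp [hH0 x hx]
  obtain ⟨N, hN0, hN⟩ : ∃ N, 0 ≤ N ∧ ∀ x, ‖H x‖ ≤ N := by
    obtain ⟨N, hN⟩ := (hcpt.image (Continuous.norm (E := ℂ →L[ℝ] ℂ →L[ℝ] ℝ) hHc)).bddAbove
    refine ⟨max N 0, le_max_right _ _, fun x => ?_⟩
    by_cases hx : x ∈ K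
    · exact (hN ⟨x, hx, rfl⟩).trans (le_max_left _ _)
    · rw [hH0 x hx]; exact (norm_zero (E := ℂ →L[ℝ] ℂ →L[ℝ] ℝ)).le.trans (le_max_right _ _)
  obtain ⟨M, hM⟩ := (isCompact_closedBall x₀ R₁).exists_bound_of_continuousOn (hv.mono hball)
  have hM0 : 0 ≤ M := (norm_nonneg (v x₀)).trans (hM x₀ hx₀)
  have hHu := hHs.uniformContinuous_of_continuous hHc
  have hWu := hWs.uniformContinuous_of_continuous hWc
  set I := ∫ z, v z * (H z 1 1 + H z Complex.I Complex.I)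
  -- `M + 1` bounds the discrete functions once they are within `ε ≤ 1` of `v`.
  set c := (4 * (M + 1) + 2 * N + 1) * volume.real (Metric.closedBall x₀ R₁) +
        2 * (C ^ 2 * (2 * R₁ + 5) ^ 2) + 2 * volume.real (Metric.closedBall x₀ R₁) with hc
  -- One lattice fine enough for `ε` suffices, and `c` depends neither on it nor on `ε`.
  have key : ∀ ε : ℝ, 0 < ε → ε ≤ 1 → |I| ≤ ε * c := by
    intro ε hε hε1
    obtain ⟨ρ₁, hρ₁, hH1⟩ := Metric.uniformContinuous_iff (β := ℂ →L[ℝ] ℂ →L[ℝ] ℝ).1 hHu ε hε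
    obtain ⟨ρ₂, hρ₂, hW1⟩ := Metric.uniformContinuous_iff (β := ℂ →L[ℝ] ℂ →L[ℝ] ℝ).1 hWu ε hε
    have hmesh : ∀ t : ℝ, 0 < t → ∀ᶠ n in atTop, (Q n).maxEdgeLength < t := fun t ht =>
      happrox.mesh.eventually (gt_mem_nhds ht)
    obtain ⟨n, n1, n2, n3, n4, n5, n6⟩ := (hinball.and ((hmesh (ρ₁ / 2) (by linarith)).and
      ((hmesh (ρ₂ / 2) (by linarith)).and ((hmesh ((R₁ - R₀) / 4) (by linarith)).and
      ((hmesh 1 one_pos).and (hconv ε hε)))))).exists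
    obtain ⟨L⟩ := (hQ n).toIsQuadrilateralLattice.nonempty_faceLabelling (hB n)
    refine L.abs_integral_laplacian_le (hQ n) (hC n).2 (hu n) hφ hR₀ hε.le (by linarith) hN0 hsupp
      (by linarith) n5.le n1 (fun x y hxy => ?_) hWc (fun x y hxy => ?_) (fun b hb hbR => ?_) hN
    · have := hH1 (a := x) (b := y) (by rw [dist_eq_norm]; linarith)
      exact (dist_eq_norm (E := ℂ →L[ℝ] ℂ →L[ℝ] ℝ) _ _).symm.le.trans this.le
    · have := hW1 (a := x) (b := y) (by rw [dist_eq_norm]; linarith)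
      exact (dist_eq_norm (E := ℂ →L[ℝ] ℂ →L[ℝ] ℝ) _ _).symm.le.trans this.le
    · have h1 := n6 b hb (hball hbR)
      have h2 := hM b hbR
      rw [Real.norm_eq_abs] at h2
      refine ⟨?_, h1.le⟩
      have := abs_add_le (u n b - v b) (v b)
      rw [sub_add_cancel] at this
      linarith
  have hlim : Tendsto (fun ε : ℝ => ε * c) (𝓝[>] 0) (𝓝 0) := by
    have : Tendsto (fun ε : ℝ => ε * c) (𝓝 0) (𝓝 (0 * c)) := tendsto_id.mul_const c
    rw [zero_mul] at this
    exact this.mono_left nhdsWithin_le_nhds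
  have hle : |I| ≤ 0 := by
    refine ge_of_tendsto hlim ?_
    filter_upwards [Ioc_mem_nhdsGT (zero_lt_one' ℝ)] with ε hε using key ε hε.1 hε.2
  exact abs_nonpos_iff.1 hle

/-! ### The Laplacian in coordinates -/

/-- The Laplacian of a function on the plane, in coordinates. -/
noncomputable def planeLaplacian (f : ℂ → ℝ) (z : ℂ) : ℝ :=
  fderiv ℝ (fderiv ℝ f) z 1 1 + fderiv ℝ (fderiv ℝ f) z Complex.I Complex.I

theorem laplacian_eq_planeLaplacian (f : ℂ → ℝ) :
    Laplacian.laplacian f = planeLaplacian f := by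
  rw [InnerProductSpace.laplacian_eq_iteratedFDeriv_complexPlane]
  funext z
  simp [planeLaplacian, iteratedFDeriv_two_apply]

theorem planeLaplacian_sub_add_const {f g : ℂ → ℝ} (hf : ContDiff ℝ 2 f) (hg : ContDiff ℝ 2 g)
    (c : ℝ) (z : ℂ) :
    planeLaplacian (fun y => f y - g y + c) z = planeLaplacian f z - planeLaplacian g z := by
  have h1 : fderiv ℝ (fun y => f y - g y + c) = fun y => fderiv ℝ f y - fderiv ℝ g y := by
    funext y
    rw [fderiv_add_const]
    exact fderiv_sub (hf.differentiable two_ne_zero y) (hg.differentiable two_ne_zero y)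
  have hf' : Differentiable ℝ (fderiv ℝ f) :=
    (hf.fderiv_right (m := 1) (by norm_num)).differentiable one_ne_zero
  have hg' : Differentiable ℝ (fderiv ℝ g) :=
    (hg.fderiv_right (m := 1) (by norm_num)).differentiable one_ne_zero
  have h2 : fderiv ℝ (fun y => fderiv ℝ f y - fderiv ℝ g y) z =
      fderiv ℝ (fderiv ℝ f) z - fderiv ℝ (fderiv ℝ g) z := fderiv_sub (hf' z) (hg' z)
  unfold planeLaplacian
  rw [h1, h2]
  simp only [sub_apply]; ring

theorem planeLaplacian_comp_smul_sub {f : ℂ → ℝ} (hf : ContDiff ℝ 2 f) (c : ℝ) (x z : ℂ) :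
    planeLaplacian (fun y => f (c • (y - x))) z = c ^ 2 * planeLaplacian f (c • (z - x)) := by
  have hA : ∀ y : ℂ, HasFDerivAt (fun y : ℂ => c • (y - x)) (c • ContinuousLinearMap.id ℝ ℂ) y :=
    fun y => ((hasFDerivAt_id y).sub_const x).const_smul c
  have h1 : fderiv ℝ (fun y => f (c • (y - x))) = fun y => c • fderiv ℝ f (c • (y - x)) := by
    funext y
    have h : HasFDerivAt (fun y => f (c • (y - x))) _ y :=
      (hf.differentiable two_ne_zero _).hasFDerivAt.comp y (hA y)
    rw [h.fderiv]
    ext w; simp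
  have hf' : Differentiable ℝ (fderiv ℝ f) :=
    (hf.fderiv_right (m := 1) (by norm_num)).differentiable one_ne_zero
  have h2 := (((hf' (c • (z - x))).hasFDerivAt.comp z (hA z)).const_smul c).fderiv
  have h3 : fderiv ℝ (fun y => c • fderiv ℝ f (c • (y - x))) z = _ := h2
  unfold planeLaplacian
  rw [h1, h3]
  simp
  ring

theorem planeLaplacian_eq_zero_off {f : ℂ → ℝ} {K : Set ℂ} (hK : IsClosed K)
    (hf : ∀ x ∉ K, f x = 0) {x : ℂ} (hx : x ∉ K) : planeLaplacian f x = 0 := by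
  have := fderiv_eq_zero_of_eq_zero_off hK (fun y hy => fderiv_eq_zero_of_eq_zero_off hK hf hy) hx
  simp [planeLaplacian, this]

/-! ### A smoothed logarithmic potential -/

/-- A smooth monotone function that vanishes up to `1 / 2` and equals `1` from `1` on. -/
noncomputable def smoothStep (t : ℝ) : ℝ := Real.smoothTransition (2 * t - 1)

theorem contDiff_smoothStep : ContDiff ℝ ((⊤ : ℕ∞) : WithTop ℕ∞) smoothStep :=
  Real.smoothTransition.contDiff.comp (by fun_prop)

theorem monotone_smoothStep : Monotone smoothStep := fun s t h =>
  Real.smoothTransition.monotone (by linarith)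

theorem smoothStep_of_le {t : ℝ} (h : t ≤ 1 / 2) : smoothStep t = 0 :=
  Real.smoothTransition.zero_of_nonpos (by linarith)

theorem smoothStep_of_ge {t : ℝ} (h : 1 ≤ t) : smoothStep t = 1 :=
  Real.smoothTransition.one_of_one_le (by linarith)

theorem contDiff_smoothStep_div :
    ContDiff ℝ ((⊤ : ℕ∞) : WithTop ℕ∞) fun t => smoothStep t / t := by
  rw [contDiff_iff_contDiffAt]
  intro t
  rcases lt_or_ge t (1 / 2) with h | h
  · refine (contDiffAt_const (c := (0 : ℝ))).congr_of_eventuallyEq ?_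
    filter_upwards [gt_mem_nhds h] with s hs
    rw [smoothStep_of_le hs.le, zero_div]
  · exact contDiff_smoothStep.contDiffAt.div contDiffAt_id (by simp; linarith)

/-- A smooth function on the line that equals the logarithm from `1` on. -/
noncomputable def smoothLog (t : ℝ) : ℝ := ∫ s in (1 : ℝ)..t, smoothStep s / s

theorem hasDerivAt_smoothLog (t : ℝ) : HasDerivAt smoothLog (smoothStep t / t) t :=
  contDiff_smoothStep_div.continuous.integral_hasStrictDerivAt 1 t |>.hasDerivAt

theorem contDiff_smoothLog : ContDiff ℝ ((⊤ : ℕ∞) : WithTop ℕ∞) smoothLog := by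
  refine contDiff_infty_iff_deriv.2 ⟨fun t => (hasDerivAt_smoothLog t).differentiableAt, ?_⟩
  have : deriv smoothLog = fun t => smoothStep t / t := funext fun t => (hasDerivAt_smoothLog t).deriv
  rw [this]
  exact contDiff_smoothStep_div

theorem smoothLog_of_ge {t : ℝ} (h : 1 ≤ t) : smoothLog t = Real.log t := by
  have : Set.EqOn (fun s => smoothStep s / s) (fun s => s⁻¹) (Set.uIcc 1 t) := by
    intro s hs
    rw [Set.uIcc_of_le h] at hs
    simp only [smoothStep_of_ge hs.1, one_div]
  rw [smoothLog, intervalIntegral.integral_congr this, integral_inv, div_one]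
  rw [Set.uIcc_of_le h]
  intro h0; linarith [h0.1]

/-- A smooth function on the plane that equals `log ‖z‖` outside the unit disk. -/
noncomputable def smoothLogNorm (z : ℂ) : ℝ := smoothLog (z.re ^ 2 + z.im ^ 2) / 2

/-- The Laplacian of `smoothLogNorm`. -/
noncomputable def logKernel (z : ℂ) : ℝ := 2 * deriv smoothStep (z.re ^ 2 + z.im ^ 2)

theorem contDiff_re_sq_add_im_sq :
    ContDiff ℝ ((⊤ : ℕ∞) : WithTop ℕ∞) fun z : ℂ => z.re ^ 2 + z.im ^ 2 :=
  (Complex.reCLM.contDiff.pow 2).add (Complex.imCLM.contDiff.pow 2)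

theorem contDiff_smoothLogNorm : ContDiff ℝ ((⊤ : ℕ∞) : WithTop ℕ∞) smoothLogNorm :=
  (contDiff_smoothLog.comp contDiff_re_sq_add_im_sq).div_const 2

theorem contDiff_logKernel : ContDiff ℝ ((⊤ : ℕ∞) : WithTop ℕ∞) logKernel :=
  contDiff_const.mul ((contDiff_infty_iff_deriv.1 contDiff_smoothStep).2.comp
    contDiff_re_sq_add_im_sq)

theorem re_sq_add_im_sq (z : ℂ) : z.re ^ 2 + z.im ^ 2 = ‖z‖ ^ 2 := by
  rw [← Complex.normSq_eq_norm_sq, Complex.normSq_apply]; ring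

theorem smoothLogNorm_of_ge {z : ℂ} (h : 1 ≤ ‖z‖) : smoothLogNorm z = Real.log ‖z‖ := by
  rw [smoothLogNorm, re_sq_add_im_sq, smoothLog_of_ge (one_le_pow₀ h), Real.log_pow]
  push_cast; ring

theorem logKernel_nonneg (z : ℂ) : 0 ≤ logKernel z :=
  mul_nonneg zero_le_two monotone_smoothStep.deriv_nonneg

theorem logKernel_eq_zero {z : ℂ} (h : z ∉ Metric.closedBall (0 : ℂ) 1) : logKernel z = 0 := by
  rw [mem_closedBall_zero_iff, not_le] at h
  have h1 : 1 < z.re ^ 2 + z.im ^ 2 := by rw [re_sq_add_im_sq]; exact one_lt_pow₀ h two_ne_zero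
  have : smoothStep =ᶠ[𝓝 (z.re ^ 2 + z.im ^ 2)] fun _ => 1 := by
    filter_upwards [lt_mem_nhds h1] with s hs using smoothStep_of_ge hs.le
  rw [logKernel, this.deriv_eq]; simp

theorem logKernel_neg (z : ℂ) : logKernel (-z) = logKernel z := by
  simp [logKernel]

theorem exists_logKernel_ne_zero : ∃ z, logKernel z ≠ 0 := by
  obtain ⟨t, ht, h⟩ := exists_deriv_eq_slope smoothStep zero_lt_one
    contDiff_smoothStep.continuous.continuousOn
    (contDiff_smoothStep.differentiable (by simp)).differentiableOn
  refine ⟨(Real.sqrt t : ℝ), ?_⟩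
  rw [logKernel, Complex.ofReal_re, Complex.ofReal_im, Real.sq_sqrt ht.1.le, zero_pow two_ne_zero,
    add_zero, h, smoothStep_of_ge le_rfl, smoothStep_of_le (by norm_num)]
  norm_num

/-- With `t = |z|²` and `γ(t) = smoothStep t / t`, the gradient is `γ(t) z`. Its divergence is `2γ +
2tγ' = 2(tγ)'`, and `tγ` is `smoothStep`. -/
theorem planeLaplacian_smoothLogNorm : planeLaplacian smoothLogNorm = logKernel := by
  set E : ℂ →L[ℝ] ℂ →L[ℝ] ℝ :=
    Complex.reCLM.smulRight Complex.reCLM + Complex.imCLM.smulRight Complex.imCLM with hE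
  have hEz : ∀ z w : ℂ, E z w = z.re * w.re + z.im * w.im := fun z w => by simp [hE]
  set γ : ℝ → ℝ := fun t => smoothStep t / t with hγ
  have hN : ∀ z : ℂ, HasFDerivAt (fun z : ℂ => z.re ^ 2 + z.im ^ 2) ((2 : ℝ) • E z) z := by
    intro z
    have h1 := (Complex.reCLM.hasFDerivAt (x := z)).pow 2
    have h2 := (Complex.imCLM.hasFDerivAt (x := z)).pow 2
    refine (h1.add h2).congr_fderiv ?_
    ext w
    simp [hEz]; ring
  have h1 : fderiv ℝ smoothLogNorm = fun z => γ (z.re ^ 2 + z.im ^ 2) • E z := by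
    funext z
    have h := (((hasDerivAt_smoothLog _).comp_hasFDerivAt z (hN z)).mul_const (2⁻¹ : ℝ))
    have h' : HasFDerivAt smoothLogNorm _ z := h
    rw [h'.fderiv]
    ext w
    simp [hγ]
    ring
  have hγd : ∀ t, DifferentiableAt ℝ γ t := contDiff_smoothStep_div.differentiable (by simp)
  funext z
  set t := z.re ^ 2 + z.im ^ 2 with ht
  have h2 : HasFDerivAt (fun z : ℂ => γ (z.re ^ 2 + z.im ^ 2) • E z)
      (γ t • E + (deriv γ t • ((2 : ℝ) • E z)).smulRight (E z)) z := by
    have h : HasFDerivAt (fun z : ℂ => γ (z.re ^ 2 + z.im ^ 2)) (deriv γ t • ((2 : ℝ) • E z)) z := by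
      have hd : HasDerivAt γ (deriv γ t) ((fun z : ℂ => z.re ^ 2 + z.im ^ 2) z) :=
        (hγd t).hasDerivAt
      exact hd.comp_hasFDerivAt z (hN z)
    exact h.smul E.hasFDerivAt
  have h3 : deriv smoothStep t = γ t + t * deriv γ t := by
    have e : smoothStep = fun t => t * γ t := by
      funext s
      rcases eq_or_ne s 0 with rfl | hs
      · rw [smoothStep_of_le (by norm_num), zero_mul]
      · simp only [hγ]; field_simp
    rw [e]
    have h : HasDerivAt (fun t => t * γ t) (1 * γ t + t * deriv γ t) t :=
      (hasDerivAt_id t).mul (hγd t).hasDerivAt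
    rw [h.deriv, one_mul]
  rw [planeLaplacian, h1, h2.fderiv, logKernel, ← ht, h3]
  simp [hEz, ht]
  ring

/-! ### Weyl's lemma through kernels obtained from the logarithm -/

section WeylLemma

open MeasureTheory

theorem two_le_infty : (2 : WithTop ℕ∞) ≤ ((⊤ : ℕ∞) : WithTop ℕ∞) :=
  WithTop.coe_le_coe.2 (le_top : (2 : ℕ∞) ≤ ⊤)

theorem hasCompactSupport_logKernel : HasCompactSupport logKernel :=
  HasCompactSupport.intro (isCompact_closedBall (0 : ℂ) 1) fun _ hx => logKernel_eq_zero hx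

theorem integral_logKernel_pos : 0 < ∫ z, logKernel z := by
  obtain ⟨z, hz⟩ := exists_logKernel_ne_zero
  exact contDiff_logKernel.continuous.integral_pos_of_hasCompactSupport_nonneg_nonzero
    hasCompactSupport_logKernel logKernel_nonneg hz

/-- The rescaling of `logKernel` to the disk of radius `ε`. -/
noncomputable def scaledLogKernel (ε : ℝ) (z : ℂ) : ℝ := ε⁻¹ ^ 2 * logKernel (ε⁻¹ • z)

theorem scaledLogKernel_nonneg (ε : ℝ) (z : ℂ) : 0 ≤ scaledLogKernel ε z :=
  mul_nonneg (sq_nonneg _) (logKernel_nonneg _)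

theorem scaledLogKernel_neg (ε : ℝ) (z : ℂ) : scaledLogKernel ε (-z) = scaledLogKernel ε z := by
  simp [scaledLogKernel, logKernel_neg]

theorem scaledLogKernel_eq_zero {ε : ℝ} (hε : 0 < ε) {z : ℂ} (hz : ε < ‖z‖) :
    scaledLogKernel ε z = 0 := by
  rw [scaledLogKernel, logKernel_eq_zero, mul_zero]
  rw [mem_closedBall_zero_iff, not_le, norm_smul, Real.norm_eq_abs, abs_of_pos (inv_pos.2 hε),
    inv_mul_eq_div, one_lt_div hε]
  exact hz

theorem contDiff_scaledLogKernel (ε : ℝ) :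
    ContDiff ℝ ((⊤ : ℕ∞) : WithTop ℕ∞) (scaledLogKernel ε) :=
  contDiff_const.mul (contDiff_logKernel.comp (contDiff_id.const_smul ε⁻¹))

theorem integral_scaledLogKernel_sub {ε : ℝ} (hε : 0 < ε) (x : ℂ) :
    ∫ y, scaledLogKernel ε (y - x) = ∫ z, logKernel z := by
  rw [integral_sub_right_eq_self (scaledLogKernel ε) x]
  simp only [scaledLogKernel]
  rw [integral_const_mul, Measure.integral_comp_smul, Complex.finrank_real_complex, smul_eq_mul,
    abs_of_pos (by positivity), ← mul_assoc, mul_inv_cancel₀ (by positivity), one_mul]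

theorem planeLaplacian_smoothLogNorm_scaled (ε : ℝ) (x z : ℂ) :
    planeLaplacian (fun y => smoothLogNorm (ε⁻¹ • (y - x))) z = scaledLogKernel ε (z - x) := by
  rw [planeLaplacian_comp_smul_sub (contDiff_smoothLogNorm.of_le two_le_infty),
    planeLaplacian_smoothLogNorm, scaledLogKernel]

theorem continuous_mul_of_eq_zero_off {Ω K : Set ℂ} (hΩ : IsOpen Ω) (hK : IsClosed K) (hKΩ : K ⊆ Ω)
    {v : ℂ → ℝ} (hv : ContinuousOn v Ω) {f : ℂ → ℝ} (hf : Continuous f) (hf0 : ∀ x ∉ K, f x = 0) :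
    Continuous fun x => v x * f x :=
  hΩ.continuous_smul_of_eq_zero_off hK hKΩ hv hf hf0

theorem integrable_mul_of_eq_zero_off {Ω K : Set ℂ} (hΩ : IsOpen Ω) (hK : IsCompact K)
    (hKΩ : K ⊆ Ω) {v : ℂ → ℝ} (hv : ContinuousOn v Ω) {f : ℂ → ℝ} (hf : Continuous f)
    (hf0 : ∀ x ∉ K, f x = 0) : Integrable fun x => v x * f x :=
  (continuous_mul_of_eq_zero_off hΩ hK.isClosed hKΩ hv hf hf0).integrable_of_hasCompactSupport
    (HasCompactSupport.intro hK fun x hx => by rw [hf0 x hx, mul_zero])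

/-- All derivatives fall on the smooth factor, so `V` need only be locally integrable. -/
theorem planeLaplacian_convolution {V K : ℂ → ℝ} (hV : LocallyIntegrable V)
    (hK : ContDiff ℝ ((⊤ : ℕ∞) : WithTop ℕ∞) K) (hKs : HasCompactSupport K) (x : ℂ) :
    planeLaplacian (convolution V K (ContinuousLinearMap.mul ℝ ℝ) volume) x =
      ∫ y, V y * planeLaplacian K (x - y) := by
  set M := ContinuousLinearMap.mul ℝ ℝ
  have hD : ContDiff ℝ 1 (fderiv ℝ K) :=
    (hK.of_le (m := 2) two_le_infty).fderiv_right (by norm_num)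
  have hK1 : ContDiff ℝ 1 K := hK.of_le (one_le_two.trans two_le_infty)
  have hDs := hKs.fderiv ℝ
  have hHs := hDs.fderiv ℝ
  have hHc : Continuous (fderiv ℝ (fderiv ℝ K)) := hD.continuous_fderiv one_ne_zero
  have h1 : fderiv ℝ (convolution V K M volume) =
      convolution V (fderiv ℝ K) (M.precompR ℂ) volume :=
    funext fun y => (hKs.hasFDerivAt_convolution_right M hV hK1 y).fderiv
  have h2 := (hDs.hasFDerivAt_convolution_right (M.precompR ℂ) hV hD x).fderiv
  have h3 : ∀ e : ℂ, fderiv ℝ (fderiv ℝ (convolution V K M volume)) x e e =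
      ∫ y, V y * fderiv ℝ (fderiv ℝ K) (x - y) e e := by
    intro e
    have hHe : Continuous fun a => fderiv ℝ (fderiv ℝ K) a e := hHc.clm_apply continuous_const
    have hHes : HasCompactSupport fun a => fderiv ℝ (fderiv ℝ K) a e :=
      hHs.comp_left (g := fun T : ℂ →L[ℝ] ℂ →L[ℝ] ℝ => T e) (by simp)
    rw [h1, h2, convolution_precompR_apply _ hV hHs hHc, convolution_precompR_apply _ hV hHes hHe]
    rfl
  have hi : ∀ e : ℂ, Integrable fun y => V y * fderiv ℝ (fderiv ℝ K) (x - y) e e := by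
    intro e
    have hHe : Continuous fun a => fderiv ℝ (fderiv ℝ K) a e e :=
      (hHc.clm_apply continuous_const).clm_apply continuous_const
    have hHes : HasCompactSupport fun a => fderiv ℝ (fderiv ℝ K) a e e :=
      hHs.comp_left (g := fun T : ℂ →L[ℝ] ℂ →L[ℝ] ℝ => T e e) (by simp)
    exact hHes.convolutionExists_right M hV hHe x
  rw [planeLaplacian, h3, h3, ← integral_add (hi 1) (hi Complex.I)]
  simp only [planeLaplacian, mul_add]

/-- Weyl's lemma in the plane for continuous functions. -/
theorem harmonicAt_of_integral_mul_planeLaplacian_eq_zero {Ω : Set ℂ} (hΩ : IsOpen Ω)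
    {v : ℂ → ℝ} (hv : ContinuousOn v Ω) {x₀ : ℂ} {R : ℝ} (hR : 0 < R)
    (hball : Metric.closedBall x₀ R ⊆ Ω)
    (hw : ∀ φ : ℂ → ℝ, ContDiff ℝ 2 φ → (∀ x ∉ Metric.closedBall x₀ R, φ x = 0) →
      ∫ z, v z * planeLaplacian φ z = 0) :
    InnerProductSpace.HarmonicAt v x₀ := by
  -- Disks of radius at most `d` about points within `d` of `x₀` remain in the ball where test
  -- functions are allowed.
  set d := R / 2 with hd
  have hd0 : 0 < d := by positivity
  set m := ∫ z, logKernel z with hm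
  have hm0 : 0 < m := integral_logKernel_pos
  have hsub : ∀ x ∈ Metric.closedBall x₀ d, ∀ ε ≤ d,
      Metric.closedBall x ε ⊆ Metric.closedBall x₀ R := fun x hx ε hε => by
    refine Metric.closedBall_subset_closedBall' ?_
    have := Metric.mem_closedBall.1 hx
    linarith
  have hker : ∀ {ε : ℝ}, 0 < ε → ∀ x : ℂ, ∀ y ∉ Metric.closedBall x ε,
      scaledLogKernel ε (y - x) = 0 := fun hε x y hy => by
    rw [Metric.mem_closedBall, not_le, dist_eq_norm] at hy
    exact scaledLogKernel_eq_zero hε hy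
  have hkc : ∀ (ε : ℝ) (x : ℂ), Continuous fun y => scaledLogKernel ε (y - x) := fun ε x =>
    (contDiff_scaledLogKernel ε).continuous.comp (continuous_id.sub continuous_const)
  have hint : ∀ x ∈ Metric.closedBall x₀ d, ∀ ε, 0 < ε → ε ≤ d →
      Integrable fun y => v y * scaledLogKernel ε (y - x) := fun x hx ε hε hεd =>
    integrable_mul_of_eq_zero_off hΩ (isCompact_closedBall x ε) ((hsub x hx ε hεd).trans hball) hv
      (hkc ε x) (hker hε x)
  have hindep : ∀ x ∈ Metric.closedBall x₀ d, ∀ ε, 0 < ε → ε ≤ d →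
      ∫ y, v y * scaledLogKernel ε (y - x) = ∫ y, v y * scaledLogKernel d (y - x) := by
    intro x hx ε hε hεd
    have hc : ∀ η : ℝ, ContDiff ℝ 2 fun y : ℂ => smoothLogNorm (η⁻¹ • (y - x)) := fun η =>
      (contDiff_smoothLogNorm.of_le two_le_infty).comp
        ((contDiff_id.sub contDiff_const).const_smul η⁻¹)
    -- Outside the disk of radius `d` both potentials are exact logarithms differing by `log d - log
    -- ε`; the added constant makes the difference vanish there, so it is an admissible test
    -- function.
    have h := hw (fun y => smoothLogNorm (ε⁻¹ • (y - x)) - smoothLogNorm (d⁻¹ • (y - x)) +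
      (Real.log ε - Real.log d)) (((hc ε).sub (hc d)).add contDiff_const) (fun y hy => by
        have hy' : d < ‖y - x‖ := by
          by_contra hle
          refine hy (hsub x hx d le_rfl ?_)
          rw [Metric.mem_closedBall, dist_eq_norm]; exact not_lt.1 hle
        have hn : 0 < ‖y - x‖ := hd0.trans hy'
        have hval : ∀ η : ℝ, 0 < η → η ≤ d →
            smoothLogNorm (η⁻¹ • (y - x)) = Real.log ‖y - x‖ - Real.log η := by
          intro η hη hηd
          have e : ‖η⁻¹ • (y - x)‖ = ‖y - x‖ / η := by
            rw [norm_smul, Real.norm_eq_abs, abs_of_pos (inv_pos.2 hη), inv_mul_eq_div]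
          rw [smoothLogNorm_of_ge, e, Real.log_div hn.ne' hη.ne']
          rw [e, one_le_div hη]; linarith
        rw [hval ε hε hεd, hval d hd0 le_rfl]; ring)
    have e : ∀ z, v z * planeLaplacian (fun y => smoothLogNorm (ε⁻¹ • (y - x)) -
        smoothLogNorm (d⁻¹ • (y - x)) + (Real.log ε - Real.log d)) z =
        v z * scaledLogKernel ε (z - x) - v z * scaledLogKernel d (z - x) := fun z => by
      rw [planeLaplacian_sub_add_const (hc ε) (hc d), planeLaplacian_smoothLogNorm_scaled,
        planeLaplacian_smoothLogNorm_scaled, mul_sub]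
    simp only [e] at h
    rw [integral_sub (hint x hx ε hε hεd) (hint x hx d hd0 le_rfl)] at h
    linarith
  -- The average does not depend on `ε`, while continuity of `v` makes it tend to `m * v x` as `ε`
  -- shrinks.
  have hrep : ∀ x ∈ Metric.closedBall x₀ d,
      m * v x = ∫ y, v y * scaledLogKernel d (y - x) := by
    intro x hx
    have hxΩ : x ∈ Ω := hball (hsub x hx 0 hd0.le (Metric.mem_closedBall_self le_rfl))
    refine eq_of_abs_sub_le_all fun η hη => ?_
    obtain ⟨ρ, hρ, hρv⟩ := Metric.continuousAt_iff.1 (hv.continuousAt (hΩ.mem_nhds hxΩ)) (η / m)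
      (div_pos hη hm0)
    set ε := min (ρ / 2) d with hε
    have hε0 : 0 < ε := lt_min (by linarith) hd0
    have hεd : ε ≤ d := min_le_right _ _
    have hερ : ε < ρ := (min_le_left _ _).trans_lt (by linarith)
    rw [← hindep x hx ε hε0 hεd, abs_sub_comm, mul_comm, hm, ← integral_scaledLogKernel_sub hε0 x,
      ← integral_const_mul]
    have hki : Integrable fun y => scaledLogKernel ε (y - x) :=
      (hkc ε x).integrable_of_hasCompactSupport
        (HasCompactSupport.intro (isCompact_closedBall x ε) (hker hε0 x))
    rw [← integral_sub (hint x hx ε hε0 hεd) (hki.const_mul _), ← Real.norm_eq_abs]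
    have hb := norm_integral_le_of_norm_le (f := fun y => v y * scaledLogKernel ε (y - x) -
      v x * scaledLogKernel ε (y - x)) (hki.const_mul (η / m)) (ae_of_all _ fun y => by
        rw [← sub_mul, norm_mul, Real.norm_of_nonneg (scaledLogKernel_nonneg _ _)]
        by_cases hy : y ∈ Metric.closedBall x ε
        · refine mul_le_mul_of_nonneg_right ?_ (scaledLogKernel_nonneg _ _)
          rw [← dist_eq_norm]
          exact (hρv ((Metric.mem_closedBall.1 hy).trans_lt hερ)).le
        · rw [hker hε0 x y hy, mul_zero, mul_zero])
    rw [integral_const_mul, integral_scaledLogKernel_sub hε0, ← hm, div_mul_cancel₀ _ hm0.ne'] at hb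
    exact hb
  -- Cutting off gives an integrable function on the plane without changing the averages near `x₀`;
  -- hence `v` agrees there with a smooth convolution.
  set V := (Metric.closedBall x₀ R).indicator v with hV
  have hVi : LocallyIntegrable V := by
    refine Integrable.locallyIntegrable ?_
    rw [hV, integrable_indicator_iff Metric.isClosed_closedBall.measurableSet]
    exact (hv.mono hball).integrableOn_compact (isCompact_closedBall x₀ R)
  have hks : HasCompactSupport (scaledLogKernel d) :=
    HasCompactSupport.intro (isCompact_closedBall (0 : ℂ) d) fun y hy => by
      have := hker hd0 0 y hy
      rwa [sub_zero] at this
  set F := convolution V (scaledLogKernel d) (ContinuousLinearMap.mul ℝ ℝ) volume with hF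
  have hFs : ContDiff ℝ ((⊤ : ℕ∞) : WithTop ℕ∞) F :=
    hks.contDiff_convolution_right _ hVi (contDiff_scaledLogKernel d)
  have hVmul : ∀ x ∈ Metric.closedBall x₀ d, ∀ f : ℂ → ℝ, (∀ y ∉ Metric.closedBall x d, f y = 0) →
      ∫ y, V y * f y = ∫ y, v y * f y := by
    intro x hx f hf
    congr 1
    funext y
    by_cases hy : y ∈ Metric.closedBall x d
    · rw [hV, Set.indicator_of_mem (hsub x hx d le_rfl hy)]
    · rw [hf y hy, mul_zero, mul_zero]
  have hsymm : ∀ x y : ℂ, scaledLogKernel d (x - y) = scaledLogKernel d (y - x) := fun x y => by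
    rw [← neg_sub, scaledLogKernel_neg]
  have hFv : ∀ x ∈ Metric.closedBall x₀ d, F x = m * v x := by
    intro x hx
    rw [hrep x hx, ← hVmul x hx _ (hker hd0 x)]
    simp only [← hsymm x]
    rfl
  -- The Laplacian moves onto the kernel, and the reflected translate of the kernel is again a test
  -- function.
  have hFΔ : ∀ x ∈ Metric.closedBall x₀ d, planeLaplacian F x = 0 := by
    intro x hx
    rw [hF, planeLaplacian_convolution hVi (contDiff_scaledLogKernel d) hks]
    have hc : ContDiff ℝ 2 (scaledLogKernel d) := (contDiff_scaledLogKernel d).of_le two_le_infty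
    have e : ∀ y, planeLaplacian (fun y => scaledLogKernel d (x - y)) y =
        planeLaplacian (scaledLogKernel d) (x - y) := by
      intro y
      have := planeLaplacian_comp_smul_sub hc (-1) x y
      simpa using this
    have hz : ∀ y ∉ Metric.closedBall x d, scaledLogKernel d (x - y) = 0 := fun y hy => by
      rw [hsymm]; exact hker hd0 x y hy
    simp only [← e]
    rw [hVmul x hx _ fun y hy => planeLaplacian_eq_zero_off Metric.isClosed_closedBall hz hy]
    exact hw _ (hc.comp (contDiff_const.sub contDiff_id)) fun y hy =>
      hz y fun h => hy (hsub x hx d le_rfl h)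
  have hnhds : Metric.closedBall x₀ d ∈ 𝓝 x₀ := Metric.closedBall_mem_nhds x₀ hd0
  have hFh : InnerProductSpace.HarmonicAt F x₀ := by
    refine ⟨(hFs.of_le two_le_infty).contDiffAt, ?_⟩
    rw [laplacian_eq_planeLaplacian]
    filter_upwards [hnhds] with x hx using hFΔ x hx
  have hvF : m⁻¹ • F =ᶠ[𝓝 x₀] v := by
    filter_upwards [hnhds] with x hx
    rw [Pi.smul_apply, hFv x hx, smul_eq_mul, inv_mul_cancel_left₀ hm0.ne']
  exact (InnerProductSpace.harmonicAt_congr_nhds hvF).1 (hFh.const_smul)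

end WeylLemma

theorem mainTheorem9
    (Ω : Set ℂ) (hΩo : IsOpen Ω) (hΩc : IsConnected Ω)
    (Q : ℕ → PlaneGraph) (hQ : ∀ n, (Q n).IsOrthogonalLattice)
    (hND : NondegenerateUniform Q)
    (happrox : ApproximatesDomain Q Ω)
    (hinside : ∃ z₀ ∈ Ω, ∀ᶠ n in atTop, z₀ ∈ (Q n).inside)
    (B : ∀ n, Set (Q n).vertices) (hB : ∀ n, (Q n).IsDiagonalClass (B n))
    (u : ∀ n, (Q n).vertices → ℝ) (hu : ∀ n, (Q n).IsDiscreteHarmonic (u n))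
    (v : ℂ → ℝ) (hv : ContinuousOn v Ω)
    (hconv : ∀ ε > 0, ∀ᶠ n in atTop, ∀ z ∈ B n, (z : ℂ) ∈ Ω → |u n z - v z| < ε) :
    InnerProductSpace.HarmonicOnNhd v Ω := by
  intro x hx
  obtain ⟨R, hR, hball⟩ := Metric.nhds_basis_closedBall.mem_iff.1 (hΩo.mem_nhds hx)
  -- Test functions are confined to half the radius, leaving room around their support for the faces
  -- that meet it.
  refine harmonicAt_of_integral_mul_planeLaplacian_eq_zero hΩo hv (R := R / 2) (half_pos hR)
    ((Metric.closedBall_subset_closedBall (by linarith)).trans hball) fun φ hφ hsupp => ?_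
  exact integral_mul_laplacian_eq_zero hΩo hΩc hQ hND happrox hinside hB hu hv hconv
    (half_pos hR).le (half_lt_self hR) hball hφ hsupp
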